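/- For $n\ge 1$ let $\mathcal S_n$ be the set of permutations $\sigma=\sigma_1\cdots\sigma_n$ of $\{1,\dots,n\}$ in one-line notation, and let $\mathrm{fp}(\sigma)$ be the number of $i$ with $\sigma_i=i$. A permutation $\sigma\in\mathcal S_n$ contains a pattern $\tau\in\mathcal S_3$ if there are positions $i_1<i_2<i_3$ such that, for all $j,k\in\{1,2,3\}$, $\sigma_{i_j}<\sigma_{i_k}$ if and only if $\tau_j<\tau_k$; otherwise $\sigma$ avoids $\tau$. Let $\mathcal S_n(\tau)$ be the set of $\sigma\in\mathcal S_n$ that avoid $\tau$, and for a real number $q>0$ let $$Z_n(q,\tau)=\sum_{\sigma\in\mathcal S_n(\tau)}q^{\mathrm{fp}(\sigma)}.$$ Lemma. Let $q>0$ and $\tau\in\{132,321,213\}$. Then, as $n\to\infty$, $$Z_n(q,\tau)\sim\begin{cases}\dfrac{4}{(3-q)^2\sqrt{\pi}}\,n^{-3/2}\,4^n & \text{if } q<3,\\[2ex] \dfrac{2}{\sqrt{\pi}}\,n^{-1/2}\,4^n & \text{if } q=3,\\[2ex] \dfrac{(q-1)(q-3)}{(q-2)^2}\left(\dfrac{(q-1)^2}{q-2}\right)^n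 & \text{if } q>3,\end{cases}$$ where $f(n)\sim g(n)$ means $\lim_{n\to\infty} f(n)/g(n)=1$. -/

import Mathlib

open Filter Asymptotics

/-- The number of fixed points of a permutation `σ` of `{0, …, n - 1}`. -/
def numFixedPoints {n : ℕ} (σ : Equiv.Perm (Fin n)) : ℕ :=
  (Finset.univ.filter fun i => σ i = i).card

/-- `σ` contains `τ` as a pattern: there are positions `i 0 < i 1 < ⋯ < i (m - 1)` at which the
values of `σ` are in the same relative order as the values of `τ`. -/
def ContainsPattern {n m : ℕ} (σ : Equiv.Perm (Fin n)) (τ : Equiv.Perm (Fin m)) : Prop :=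
  ∃ i : Fin m → Fin n, StrictMono i ∧ ∀ j k : Fin m, σ (i j) < σ (i k) ↔ τ j < τ k

open Classical in
/-- The set of the permutations of length `n` that avoid `τ`. -/
noncomputable def avoidingPerms (n : ℕ) {m : ℕ} (τ : Equiv.Perm (Fin m)) :
    Finset (Equiv.Perm (Fin n)) :=
  Finset.univ.filter fun σ => ¬ ContainsPattern σ τ

/-- The weighted count `Z_n(q, τ)`: the sum of `q ^ fp(σ)` over all `σ` of length `n` avoiding
`τ`. -/
noncomputable def avoidingZ (n : ℕ) (q : ℝ) {m : ℕ} (τ : Equiv.Perm (Fin m)) : ℝ :=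
  ∑ σ ∈ avoidingPerms n τ, q ^ numFixedPoints σ

/-- The pattern `132`, in one-line notation with values lowered by one. -/
def pattern132 : Equiv.Perm (Fin 3) :=
  ⟨![0, 2, 1], ![0, 2, 1], by decide, by decide⟩

/-- The pattern `321`, in one-line notation with values lowered by one. -/
def pattern321 : Equiv.Perm (Fin 3) :=
  ⟨![2, 1, 0], ![2, 1, 0], by decide, by decide⟩

/-- The pattern `213`, in one-line notation with values lowered by one. -/
def pattern213 : Equiv.Perm (Fin 3) :=
  ⟨![1, 0, 2], ![1, 0, 2], by decide, by decide⟩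

/-! Put `t = q - 1` and let C be the Catalan generating function, C = 1 + XC². For each of the three
patterns the generating function of `avoidingZ` satisfies Z = C + tXCZ, the equation of Dyck paths
weighted by q per hill (`IsHillSequence`).

For 321, a fixed point splits the permutation into a direct sum. Expanding each factor q of the
weight as 1 + t and singling out the last chosen fixed point leaves a weighted 321-avoider before it
and an unweighted one after it (`avoidingZ_321_expand`). The unweighted ones are counted by Catalan
numbers, through a refinement by ballot numbers (`card_avoidingIncreasing`).

For 132, cutting at the maximum gives a skew sum, which moves the diagonal. So the statistic is
generalized to entries on a diagonal shifted by d, and the resulting recurrence is solved in closed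
form by Catalan convolutions truncated at |d| (`IsHillSequence.shiftedSum_eq`). At d = 0 the
truncation disappears and the 321 value is recovered. Reverse-complement carries 213 to 132 and
preserves the number of fixed points.

Eliminating the product CZ gives (t - 1 - t²X)Z = t - C, a first-order linear recurrence. The
regimes reflect whether the pole (t - 1)/t² contributes besides the Catalan singularity 1/4. If |t|
< 2, Z expands as a sum of ballot numbers times powers of t, and dominated convergence applies after
division by the Catalan number. If t = 2 there is a closed form. If t > 2 the pole dominates, and
its residue comes from the value of C there. -/

open scoped Topology

/-! ### The functional equation and its linear recurrence -/

/-- The sequences whose generating function `Z` satisfies `Z = C + t X C Z`, where `C` is the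
generating function of the Catalan numbers. -/
def IsHillSequence (t : ℝ) (z : ℕ → ℝ) : Prop :=
  z 0 = 1 ∧ ∀ n, z (n + 1) = catalan (n + 1) +
    t * ∑ p ∈ Finset.HasAntidiagonal.antidiagonal n, (catalan p.1 : ℝ) * z p.2

theorem catalan_succ_antidiagonal_real (n : ℕ) : (catalan (n + 1) : ℝ) =
    ∑ p ∈ Finset.HasAntidiagonal.antidiagonal n, (catalan p.1 : ℝ) * catalan p.2 := by
  rw [catalan_succ']; push_cast; rfl

theorem mk_catalan_eq : (PowerSeries.mk fun n => (catalan n : ℝ)) =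
    1 + PowerSeries.X * (PowerSeries.mk fun n => (catalan n : ℝ)) ^ 2 := by
  ext n
  cases n with
  | zero => simp
  | succ n =>
    rw [map_add, PowerSeries.coeff_succ_X_mul, pow_two, PowerSeries.coeff_mul]
    simp [catalan_succ_antidiagonal_real, PowerSeries.coeff_one]

theorem IsHillSequence.mk_eq {t : ℝ} {z : ℕ → ℝ} (h : IsHillSequence t z) :
    PowerSeries.mk z = (PowerSeries.mk fun n => (catalan n : ℝ)) +
      PowerSeries.C t * (PowerSeries.X *
        ((PowerSeries.mk fun n => (catalan n : ℝ)) * PowerSeries.mk z)) := by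
  ext n
  cases n with
  | zero => simp [h.1]
  | succ n =>
    rw [map_add, PowerSeries.coeff_C_mul, PowerSeries.coeff_succ_X_mul, PowerSeries.coeff_mul]
    simp [h.2]

theorem IsHillSequence.recurrence {t : ℝ} {z : ℕ → ℝ} (h : IsHillSequence t z) (n : ℕ) :
    (t - 1) * z (n + 1) = t ^ 2 * z n - catalan (n + 1) := by
  have hz := h.mk_eq
  have hc := mk_catalan_eq
  set Z := PowerSeries.mk z
  set K := PowerSeries.mk fun n => (catalan n : ℝ)
  have hne : (1 - PowerSeries.C t * (PowerSeries.X * K)) ≠ 0 := by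
    intro h0
    have := congrArg PowerSeries.constantCoeff h0
    simp at this
  -- Multiplied by 1 - tXC, which has constant term 1 and so can be cancelled, this becomes a
  -- combination of the equations for Z and for C.
  have key : (PowerSeries.C t - 1 - PowerSeries.C t ^ 2 * PowerSeries.X) * Z
      - (PowerSeries.C t - K) = 0 := by
    refine (mul_eq_zero.mp ?_).resolve_left hne
    linear_combination (PowerSeries.C t - 1 - PowerSeries.C t ^ 2 * PowerSeries.X) * hz
      + PowerSeries.C t * hc
  have := congrArg (PowerSeries.coeff (n + 1)) key
  have e : (PowerSeries.C t - 1 - PowerSeries.C t ^ 2 * PowerSeries.X) * Z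
      - (PowerSeries.C t - K) = PowerSeries.C (t - 1) * Z
        - PowerSeries.C (t ^ 2) * (PowerSeries.X * Z) - PowerSeries.C t + K := by
    simp only [map_sub, map_one, map_pow]; ring
  rw [e, map_add, map_sub, map_sub] at this
  simp only [PowerSeries.coeff_C_mul, PowerSeries.coeff_succ_X_mul,
    PowerSeries.coeff_C, map_zero, Z, K, PowerSeries.coeff_mk, Nat.succ_ne_zero, if_false] at this
  linarith

theorem eq_of_recurrence {t : ℝ} {z w : ℕ → ℝ} (h0 : z 0 = w 0)
    (hz : ∀ n, (t - 1) * z (n + 1) = t ^ 2 * z n - catalan (n + 1))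
    (hw : ∀ n, (t - 1) * w (n + 1) = t ^ 2 * w n - catalan (n + 1)) : z = w := by
  funext n
  by_cases ht : t = 1
  -- For t = 1 the left side vanishes and the recurrence gives each term outright, with no
  -- induction.
  · subst ht
    have h1 := hz n
    have h2 := hw n
    linarith
  · have ht' : t - 1 ≠ 0 := sub_ne_zero.mpr ht
    induction n with
    | zero => exact h0
    | succ n ih =>
      apply mul_left_cancel₀ ht'
      rw [hz, hw, ih]

/-! ### Ballot numbers and the expansion in powers of `t` -/

/-- The ballot number `(k + 1) / (n + 1) * (2 n - k).choose n`, and `0` for `k > n`. -/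
noncomputable def ballot (n k : ℕ) : ℝ :=
  catalan n * ((k + 1) * ∏ i ∈ Finset.range k, ((n : ℝ) - i) / (2 * n - i))

theorem catalan_succ_mul_real (n : ℕ) :
    (catalan (n + 1) : ℝ) * (n + 2) = catalan n * (2 * (2 * n + 1)) := by
  have h1 : ((n : ℝ) + 1) * catalan n = n.centralBinom := by
    exact_mod_cast succ_mul_catalan_eq_centralBinom n
  have h2 : ((n : ℝ) + 1 + 1) * catalan (n + 1) = (n + 1).centralBinom := by
    exact_mod_cast succ_mul_catalan_eq_centralBinom (n + 1)
  have h3 : ((n : ℝ) + 1) * (n + 1).centralBinom = 2 * (2 * n + 1) * n.centralBinom := by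
    exact_mod_cast Nat.succ_mul_centralBinom_succ n
  have : (n : ℝ) + 1 ≠ 0 := by positivity
  apply mul_left_cancel₀ this
  rw [← h1, ← h2] at h3
  linarith

theorem prod_range_ballot_eq_zero {n k : ℕ} (h : n < k) :
    ∏ i ∈ Finset.range k, ((n : ℝ) - i) / (2 * n - i) = 0 :=
  Finset.prod_eq_zero (Finset.mem_range.mpr h) (by simp)

theorem ballot_eq_zero {n k : ℕ} (h : n < k) : ballot n k = 0 := by
  simp [ballot, prod_range_ballot_eq_zero h]

theorem ballot_zero_right (n : ℕ) : ballot n 0 = catalan n := by simp [ballot]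

theorem ballot_succ_one (n : ℕ) : ballot (n + 1) 1 = ballot (n + 1) 0 := by
  have : (n : ℝ) + 1 ≠ 0 := by positivity
  simp only [ballot, Finset.prod_range_one, Finset.prod_range_zero]
  push_cast
  field_simp
  ring

theorem prod_range_ballot_succ {n k : ℕ} (h : k ≤ n) :
    ∏ i ∈ Finset.range (k + 1), (((n + 1 : ℕ) : ℝ) - i) / (2 * (n + 1 : ℕ) - i) =
    (∏ i ∈ Finset.range k, ((n : ℝ) - i) / (2 * n - i)) *
      ((2 * n - k + 1) / (2 * (2 * n + 1))) := by
  induction k with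
  | zero =>
    have : (n : ℝ) + 1 ≠ 0 := by positivity
    have : 2 * (n : ℝ) + 1 ≠ 0 := by positivity
    rw [zero_add, Finset.prod_range_one, Finset.prod_range_zero]
    push_cast
    rw [sub_zero, sub_zero, sub_zero]
    field_simp
  | succ k ih =>
    rw [Finset.prod_range_succ, ih (by omega), Finset.prod_range_succ _ k]
    generalize ∏ i ∈ Finset.range k, ((n : ℝ) - i) / (2 * n - i) = r
    have h1 : (k : ℝ) + 1 ≤ n := by exact_mod_cast h
    have hk : (0 : ℝ) ≤ k := by positivity
    have : 2 * (n : ℝ) - k ≠ 0 := by linarith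
    have : 2 * (n : ℝ) + 1 ≠ 0 := by positivity
    have : 2 * ((n : ℝ) + 1) - (k + 1) ≠ 0 := by linarith
    push_cast
    field_simp
    ring

theorem ballot_recurrence (n k : ℕ) :
    ballot (n + 1) (k + 1) = ballot (n + 1) (k + 2) + ballot n k := by
  rcases lt_or_ge n k with h | h
  · rw [ballot_eq_zero h, ballot_eq_zero (by omega), ballot_eq_zero (by omega), add_zero]
  · have hc := catalan_succ_mul_real n
    have h1 : (k : ℝ) ≤ n := by exact_mod_cast h
    have hk : (0 : ℝ) ≤ k := by positivity
    have h2 : (n : ℝ) + 2 ≠ 0 := by positivity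
    have hc' : (catalan (n + 1) : ℝ) = catalan n * (2 * (2 * n + 1)) / (n + 2) := by
      rw [eq_div_iff h2, hc]
    unfold ballot
    rw [Finset.prod_range_succ _ (k + 1), prod_range_ballot_succ h, hc']
    have : 2 * (n : ℝ) + 1 ≠ 0 := by positivity
    have : 2 * ((n : ℝ) + 1) - (k + 1) ≠ 0 := by linarith
    push_cast
    field_simp
    ring

theorem sum_Icc_ballot {n k : ℕ} (h : k ≤ n) :
    ∑ j ∈ Finset.Icc k n, ballot n j = ballot (n + 1) (k + 1) := by
  induction h using Nat.decreasingInduction with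
  | self =>
    rw [Finset.Icc_self, Finset.sum_singleton, ballot_recurrence,
      ballot_eq_zero (show n + 1 < n + 2 by omega), zero_add]
  | of_succ k hk ih =>
    rw [← Finset.insert_Icc_add_one_left_eq_Icc (by omega), Finset.sum_insert (by simp), ih,
      ballot_recurrence n k]
    ring

/-- Peeling one term and peeling two terms off the sum for n + 1 give two expressions for it. In t
times the first minus the second, the ballot recurrence collapses the differences to the sum for n,
and `ballot_succ_one` cancels the leftover linear term. -/
theorem ballotSum_recurrence (t : ℝ) (n : ℕ) :
    (t - 1) * ∑ k ∈ Finset.range (n + 2), t ^ k * ballot (n + 1) k =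
      t ^ 2 * ∑ k ∈ Finset.range (n + 1), t ^ k * ballot n k - catalan (n + 1) := by
  have e1 : ∑ k ∈ Finset.range (n + 2), t ^ k * ballot (n + 1) k = ballot (n + 1) 0 +
      t * ballot (n + 1) 1 + t ^ 2 * ∑ k ∈ Finset.range (n + 1),
        t ^ k * ballot (n + 1) (k + 2) := by
    have : ∑ k ∈ Finset.range (n + 3), t ^ k * ballot (n + 1) k =
        ∑ k ∈ Finset.range (n + 2), t ^ k * ballot (n + 1) k := by
      rw [Finset.sum_range_succ, ballot_eq_zero (show n + 1 < n + 2 by omega), mul_zero, add_zero]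
    rw [← this, Finset.sum_range_succ', Finset.sum_range_succ', Finset.mul_sum]
    have : ∀ k, t ^ (k + 1 + 1) * ballot (n + 1) (k + 1 + 1) =
      t ^ 2 * (t ^ k * ballot (n + 1) (k + 2)) := fun k => by ring_nf
    simp only [this]
    ring
  have e2 : ∑ k ∈ Finset.range (n + 2), t ^ k * ballot (n + 1) k = ballot (n + 1) 0 +
      t * ∑ k ∈ Finset.range (n + 1), t ^ k * ballot (n + 1) (k + 1) := by
    rw [Finset.sum_range_succ', Finset.mul_sum]
    have : ∀ k, t ^ (k + 1) * ballot (n + 1) (k + 1) =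
      t * (t ^ k * ballot (n + 1) (k + 1)) := fun k => by ring_nf
    simp only [this]
    ring
  have e3 : ∑ k ∈ Finset.range (n + 1), t ^ k * ballot (n + 1) (k + 1) =
      ∑ k ∈ Finset.range (n + 1), t ^ k * ballot (n + 1) (k + 2) +
      ∑ k ∈ Finset.range (n + 1), t ^ k * ballot n k := by
    rw [← Finset.sum_add_distrib]
    exact Finset.sum_congr rfl fun k _ => by rw [ballot_recurrence]; ring
  rw [ballot_succ_one, ballot_zero_right] at e1
  rw [ballot_zero_right] at e2
  rw [e3] at e2
  linear_combination t * e2 - e1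

theorem IsHillSequence.eq_ballotSum {t : ℝ} {z : ℕ → ℝ} (h : IsHillSequence t z) (n : ℕ) :
    z n = ∑ k ∈ Finset.range (n + 1), t ^ k * ballot n k := by
  refine congrFun (eq_of_recurrence (t := t) (z := z)
    (w := fun n => ∑ k ∈ Finset.range (n + 1), t ^ k * ballot n k) ?_ h.recurrence
    (ballotSum_recurrence t)) n
  simp [h.1, ballot_zero_right]

/-! ### Asymptotics in the three regimes -/

theorem centralBinom_isEquivalent :
    (fun n : ℕ => (n.centralBinom : ℝ)) ~[atTop]
      fun n => 4 ^ n / (Real.sqrt Real.pi * Real.sqrt n) := by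
  have h := Stirling.factorial_isEquivalent_stirling
  have h2 := h.comp_tendsto
    (tendsto_id.const_mul_atTop' (r := 2) two_pos : Tendsto (fun n : ℕ => 2 * n) atTop atTop)
  have h3 := h2.div (h.mul h)
  refine (IsEquivalent.refl.congr_left ?_ |>.trans h3).trans (IsEquivalent.refl.congr_left ?_)
  · refine Eventually.of_forall fun n => ?_
    have : (n.factorial : ℝ) ≠ 0 := by positivity
    have e : (n.centralBinom : ℝ) * (n.factorial * n.factorial) = (2 * n).factorial := by
      have := Nat.choose_mul_factorial_mul_factorial (show n ≤ 2 * n by omega)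
      rw [show 2 * n - n = n by omega, ← Nat.centralBinom_eq_two_mul_choose, mul_assoc] at this
      exact_mod_cast this
    simp only [Pi.div_apply, Pi.mul_apply, Function.comp]
    rw [← e]
    field_simp
  · filter_upwards [eventually_gt_atTop 0] with n hn
    have hn' : (0 : ℝ) < n := by exact_mod_cast hn
    simp only [Pi.div_apply, Pi.mul_apply, Function.comp]
    push_cast
    rw [show 2 * (2 * (n : ℝ)) * Real.pi = 2 ^ 2 * (n * Real.pi) by ring,
      Real.sqrt_mul (by positivity), Real.sqrt_sq (by positivity),
      mul_mul_mul_comm, Real.mul_self_sqrt (by positivity), Real.sqrt_mul (by positivity)]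
    have h1 : Real.sqrt n * Real.sqrt n = n := Real.mul_self_sqrt (by positivity)
    have h2 : Real.sqrt Real.pi * Real.sqrt Real.pi = Real.pi :=
      Real.mul_self_sqrt Real.pi_pos.le
    have h3 : (2 * (n : ℝ) / Real.exp 1) ^ (2 * n) =
        4 ^ n * ((n / Real.exp 1) ^ n * (n / Real.exp 1) ^ n) := by
      rw [← mul_pow, ← mul_pow, pow_mul]; congr 1; ring
    have h4 : (n / Real.exp 1) ^ n ≠ 0 := by positivity
    have h5 : Real.sqrt n ≠ 0 := by positivity
    have h6 : Real.sqrt Real.pi ≠ 0 := by positivity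
    rw [h3]
    generalize (n / Real.exp 1) ^ n = a at *
    field_simp
    linear_combination -(Real.sqrt Real.pi * Real.sqrt Real.pi) * h1 - n * h2

theorem rpow_neg_half {x : ℝ} (hx : 0 < x) : x ^ (-(1 / 2) : ℝ) = 1 / Real.sqrt x := by
  rw [Real.rpow_neg hx.le, Real.sqrt_eq_rpow, one_div, one_div]

theorem rpow_neg_three_halves {x : ℝ} (hx : 0 < x) :
    x ^ (-(3 / 2) : ℝ) = 1 / (x * Real.sqrt x) := by
  rw [show (-(3 / 2) : ℝ) = -(1 / 2) - 1 by norm_num, Real.rpow_sub_one hx.ne',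
    rpow_neg_half hx, div_div, mul_comm x]

theorem catalan_isEquivalent :
    (fun n : ℕ => (catalan n : ℝ)) ~[atTop]
      fun n => 1 / Real.sqrt Real.pi * (n : ℝ) ^ (-(3 / 2) : ℝ) * 4 ^ n := by
  have hn : (fun n : ℕ => (n : ℝ) + 1) ~[atTop] fun n => (n : ℝ) := by
    refine IsEquivalent.add_isLittleO IsEquivalent.refl ?_
    exact isLittleO_const_left.mpr (Or.inr
      (tendsto_norm_atTop_atTop.comp tendsto_natCast_atTop_atTop))
  refine (IsEquivalent.refl.congr_left ?_ |>.trans (centralBinom_isEquivalent.div hn)).trans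
    (IsEquivalent.refl.congr_left ?_)
  · refine Eventually.of_forall fun n => ?_
    have : (n : ℝ) + 1 ≠ 0 := by positivity
    have e : ((n : ℝ) + 1) * catalan n = n.centralBinom := by
      exact_mod_cast succ_mul_catalan_eq_centralBinom n
    simp only [Pi.div_apply]
    rw [← e]
    field_simp
  · filter_upwards [eventually_gt_atTop 0] with n hn
    have hn' : (0 : ℝ) < n := by exact_mod_cast hn
    have h5 : Real.sqrt n ≠ 0 := by positivity
    have h6 : Real.sqrt Real.pi ≠ 0 := by positivity
    simp only [Pi.div_apply]
    rw [rpow_neg_three_halves hn']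
    field_simp

/-- At t = 2 the pole meets the singularity 1/4 and the dominating series diverges, but the
recurrence has an exact solution in central binomial coefficients. -/
theorem IsHillSequence.isEquivalent_of_eq_two {z : ℕ → ℝ} (h : IsHillSequence 2 z) :
    z ~[atTop] fun n : ℕ =>
      2 / Real.sqrt Real.pi * (n : ℝ) ^ (-(1 / 2) : ℝ) * (4 : ℝ) ^ n := by
  have key : ∀ n : ℕ, z n * (n + 1) = (2 * n + 1) * n.centralBinom := by
    intro n
    induction n with
    | zero => simp [h.1]
    | succ n ih =>
      have hr := h.recurrence n
      have h2 : ((n : ℝ) + 1 + 1) * catalan (n + 1) = (n + 1).centralBinom := by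
        exact_mod_cast succ_mul_catalan_eq_centralBinom (n + 1)
      have h3 : ((n : ℝ) + 1) * (n + 1).centralBinom = 2 * (2 * n + 1) * n.centralBinom := by
        exact_mod_cast Nat.succ_mul_centralBinom_succ n
      have hn : (n : ℝ) + 1 ≠ 0 := by positivity
      apply mul_left_cancel₀ hn
      push_cast
      linear_combination (n + 1) * (n + 2) * hr + 4 * (n + 2) * ih
        - (n + 1) * h2 - 2 * (n + 2) * h3
  -- The factor (2n + 1)/(n + 1) from `key`, rewritten.
  have hlim : Tendsto (fun n : ℕ => 2 - 1 / ((n : ℝ) + 1)) atTop (𝓝 2) := by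
    simpa using tendsto_const_nhds.sub (tendsto_one_div_add_atTop_nhds_zero_nat (𝕜 := ℝ))
  have h2 : (fun n : ℕ => 2 - 1 / ((n : ℝ) + 1)) ~[atTop] fun _ => (2 : ℝ) :=
    (isEquivalent_const_iff_tendsto two_ne_zero).mpr hlim
  refine (IsEquivalent.refl.congr_left ?_ |>.trans (h2.mul centralBinom_isEquivalent)).trans
    (IsEquivalent.refl.congr_left ?_)
  · refine Eventually.of_forall fun n => ?_
    have hn : (n : ℝ) + 1 ≠ 0 := by positivity
    apply mul_right_cancel₀ hn
    simp only [Pi.mul_apply]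
    rw [key]
    field_simp
    ring
  · filter_upwards [eventually_gt_atTop 0] with n hn
    have hn' : (0 : ℝ) < n := by exact_mod_cast hn
    have h5 : Real.sqrt n ≠ 0 := by positivity
    have h6 : Real.sqrt Real.pi ≠ 0 := by positivity
    simp only [Pi.mul_apply]
    rw [rpow_neg_half hn']
    field_simp

theorem tendsto_ballot_factor (i : ℕ) :
    Tendsto (fun n : ℕ => ((n : ℝ) - i) / (2 * n - i)) atTop (𝓝 (1 / 2)) := by
  have h0 : Tendsto (fun n : ℕ => (i : ℝ) / n) atTop (𝓝 0) :=
    tendsto_const_div_atTop_nhds_zero_nat _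
  have h1 : Tendsto (fun n : ℕ => (1 - (i : ℝ) / n) / (2 - (i : ℝ) / n)) atTop
      (𝓝 ((1 - 0) / (2 - 0))) :=
    (tendsto_const_nhds.sub h0).div (tendsto_const_nhds.sub h0) (by norm_num)
  rw [sub_zero, sub_zero] at h1
  refine h1.congr' ?_
  filter_upwards [eventually_gt_atTop 0] with n hn
  have hn' : (n : ℝ) ≠ 0 := by positivity
  rw [← mul_div_mul_left _ _ hn', mul_sub, mul_sub, mul_div_cancel₀ _ hn']
  ring_nf

/-- Every factor with i < n is at most its limit 1/2, so the geometric bound is uniform in n, as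
dominated convergence requires. For k > n the product contains a zero factor. -/
theorem prod_ballot_factor_bounds (n k : ℕ) :
    0 ≤ ∏ i ∈ Finset.range k, ((n : ℝ) - i) / (2 * n - i) ∧
      ∏ i ∈ Finset.range k, ((n : ℝ) - i) / (2 * n - i) ≤ (1 / 2) ^ k := by
  rcases lt_or_ge n k with h | h
  · rw [prod_range_ballot_eq_zero h]
    exact ⟨le_rfl, by positivity⟩
  · have hb : ∀ i ∈ Finset.range k,
        0 ≤ ((n : ℝ) - i) / (2 * n - i) ∧ ((n : ℝ) - i) / (2 * n - i) ≤ 1 / 2 := by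
      intro i hi
      have h1 : (i : ℝ) + 1 ≤ n := by
        exact_mod_cast (Finset.mem_range.mp hi).trans_le h
      have h0 : (0 : ℝ) ≤ i := by positivity
      refine ⟨div_nonneg (by linarith) (by linarith), ?_⟩
      rw [div_le_div_iff₀ (by linarith) two_pos]
      linarith
    refine ⟨Finset.prod_nonneg fun i hi => (hb i hi).1, ?_⟩
    calc _ ≤ ∏ i ∈ Finset.range k, (1 / 2 : ℝ) :=
          Finset.prod_le_prod (fun i hi => (hb i hi).1) fun i hi => (hb i hi).2
      _ = _ := by simp

theorem hasSum_succ_mul_geometric {x : ℝ} (hx : |x| < 1) :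
    HasSum (fun n : ℕ => ((n : ℝ) + 1) * x ^ n) (1 / (1 - x) ^ 2) := by
  have h := (hasSum_coe_mul_geometric_of_norm_lt_one (r := x) hx).add
    (hasSum_geometric_of_norm_lt_one (ξ := x) hx)
  have h1 : 1 - x ≠ 0 := by linarith [(abs_lt.mp hx).2]
  have e : 1 / (1 - x) ^ 2 = x / (1 - x) ^ 2 + (1 - x)⁻¹ := by
    field_simp
    ring
  rw [e]
  exact h.congr_fun fun n => add_one_mul _ _

theorem IsHillSequence.isEquivalent_of_abs_lt_two {t : ℝ} (ht : |t| < 2) {z : ℕ → ℝ}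
    (h : IsHillSequence t z) :
    z ~[atTop] fun n : ℕ => 4 / ((2 - t) ^ 2 * Real.sqrt Real.pi) *
      (n : ℝ) ^ (-(3 / 2) : ℝ) * (4 : ℝ) ^ n := by
  have ht2 : |t / 2| < 1 := by rw [abs_div, abs_two]; linarith
  have ht3 : (2 - t) ≠ 0 := by linarith [(abs_lt.mp ht).2]
  let r : ℕ → ℕ → ℝ := fun n k =>
    t ^ k * ((k + 1) * ∏ i ∈ Finset.range k, ((n : ℝ) - i) / (2 * n - i))
  have hlim : Tendsto (fun n => ∑' k, r n k) atTop (𝓝 (∑' k : ℕ, ((k : ℝ) + 1) * (t / 2) ^ k)) := by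
    refine tendsto_tsum_of_dominated_convergence
      (bound := fun k : ℕ => ((k : ℝ) + 1) * |t / 2| ^ k)
      (hasSum_succ_mul_geometric (by rwa [abs_abs])).summable (fun k => ?_)
      (Eventually.of_forall fun n k => ?_)
    · have h1 := tendsto_finsetProd (Finset.range k) fun i _ => tendsto_ballot_factor i
      have h2 := (h1.const_mul ((k : ℝ) + 1)).const_mul (t ^ k)
      convert h2 using 2
      rw [Finset.prod_const, Finset.card_range, div_pow, div_pow, one_pow]
      ring
    · have hb := prod_ballot_factor_bounds n k
      simp only [r]
      rw [norm_mul, norm_mul, norm_pow, Real.norm_eq_abs, Real.norm_eq_abs, Real.norm_eq_abs,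
        abs_of_nonneg hb.1, abs_of_nonneg (by positivity : (0 : ℝ) ≤ k + 1), abs_div, abs_two]
      calc |t| ^ k * ((k + 1) * _) ≤ |t| ^ k * ((k + 1) * (1 / 2) ^ k) := by
            gcongr; exact hb.2
        _ = _ := by rw [div_pow, div_pow, one_pow]; ring
  rw [(hasSum_succ_mul_geometric ht2).tsum_eq] at hlim
  have hz : ∀ n, z n = (∑' k, r n k) * catalan n := by
    intro n
    -- The series is really finite: its terms vanish beyond n.
    rw [h.eq_ballotSum, tsum_eq_sum (s := Finset.range (n + 1)), Finset.sum_mul]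
    · exact Finset.sum_congr rfl fun k _ => by simp only [r, ballot]; ring
    · intro k hk
      simp only [r]
      rw [prod_range_ballot_eq_zero (by simpa using hk)]
      ring
  have h1 : (1 - t / 2) ≠ 0 := by intro h0; apply ht3; linarith
  have h2 := (isEquivalent_const_iff_tendsto (by positivity)).mpr hlim
  refine (IsEquivalent.refl.congr_left (Eventually.of_forall fun n => (hz n).symm) |>.trans
    (h2.mul catalan_isEquivalent)).trans (IsEquivalent.refl.congr_left ?_)
  refine Eventually.of_forall fun n => ?_
  simp only [Pi.mul_apply]
  have h6 : Real.sqrt Real.pi ≠ 0 := by positivity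
  have e : 1 / (1 - t / 2) ^ 2 = 4 / (2 - t) ^ 2 := by
    field_simp; ring
  rw [Function.const_apply, e]
  field_simp

theorem sum_range_catalan_quarter (n : ℕ) :
    ∑ j ∈ Finset.range n, (catalan j : ℝ) * (1 / 4) ^ j = 2 - 2 * n.centralBinom * (1 / 4) ^ n := by
  induction n with
  | zero => simp
  | succ n ih =>
    have h2 : ((n : ℝ) + 1) * catalan n = n.centralBinom := by
      exact_mod_cast succ_mul_catalan_eq_centralBinom n
    have h3 : ((n : ℝ) + 1) * (n + 1).centralBinom = 2 * (2 * n + 1) * n.centralBinom := by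
      exact_mod_cast Nat.succ_mul_centralBinom_succ n
    have hn : (n : ℝ) + 1 ≠ 0 := by positivity
    apply mul_left_cancel₀ hn
    rw [Finset.sum_range_succ, ih, pow_succ]
    linear_combination (1 / 4 : ℝ) ^ n * h2 + (1 / 4 : ℝ) ^ n / 2 * h3

theorem sum_range_catalan_le {x : ℝ} (hx0 : 0 ≤ x) (hx : x ≤ 1 / 4) (n : ℕ) :
    ∑ j ∈ Finset.range n, (catalan j : ℝ) * x ^ j ≤ 2 :=
  calc _ ≤ ∑ j ∈ Finset.range n, (catalan j : ℝ) * (1 / 4) ^ j := by gcongr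
    _ ≤ 2 := by
      rw [sum_range_catalan_quarter]
      have : (0 : ℝ) ≤ 2 * n.centralBinom * (1 / 4) ^ n := by positivity
      linarith

/-- The bound s ≤ 2 is kept in order to select the correct root of the quadratic later. It comes
from the explicit partial sums at 1/4. -/
theorem hasSum_catalan {x : ℝ} (hx0 : 0 ≤ x) (hx : x ≤ 1 / 4) :
    ∃ s, s ≤ 2 ∧ s = 1 + x * s ^ 2 ∧ HasSum (fun j : ℕ => (catalan j : ℝ) * x ^ j) s := by
  have hs : Summable (fun j : ℕ => (catalan j : ℝ) * x ^ j) :=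
    summable_of_sum_range_le (fun _ => by positivity) (sum_range_catalan_le hx0 hx)
  refine ⟨_, hs.tsum_le_of_sum_range_le (sum_range_catalan_le hx0 hx), ?_, hs.hasSum⟩
  have hn : Summable (fun j : ℕ => ‖(catalan j : ℝ) * x ^ j‖) := hs.norm
  rw [pow_two, tsum_mul_tsum_eq_tsum_sum_antidiagonal_of_summable_norm hn hn, ← tsum_mul_left,
    hs.tsum_eq_zero_add]
  simp only [catalan_zero, Nat.cast_one, pow_zero, mul_one]
  congr 1
  refine tsum_congr fun j => ?_
  rw [catalan_succ_antidiagonal_real, Finset.sum_mul, Finset.mul_sum]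
  refine Finset.sum_congr rfl fun p hp => ?_
  rw [pow_succ, ← Finset.HasAntidiagonal.mem_antidiagonal.mp hp, pow_add]; ring

theorem IsHillSequence.isEquivalent_of_two_lt {t : ℝ} (ht : 2 < t) {z : ℕ → ℝ}
    (h : IsHillSequence t z) :
    z ~[atTop] fun n : ℕ => t * (t - 2) / (t - 1) ^ 2 * (t ^ 2 / (t - 1)) ^ n := by
  have ht1 : 0 < t - 1 := by linarith
  have ht2 : 0 < t - 2 := by linarith
  have ht0 : 0 < t := by linarith
  set x := (t - 1) / t ^ 2 with hx
  have hxpos : 0 < x := by positivity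
  have hx4 : x ≤ 1 / 4 := by
    rw [hx, div_le_div_iff₀ (by positivity) (by norm_num)]
    nlinarith [sq_nonneg (t - 2)]
  obtain ⟨s, hs2, hs, hsum⟩ := hasSum_catalan hxpos.le hx4
  have hs' : s = t / (t - 1) := by
    -- For this x the quadratic s = 1 + xs² has the roots t and t/(t - 1); since s ≤ 2 < t, the
    -- first is excluded.
    have : (s - t) * ((t - 1) * s - t) = 0 := by
      rw [hx] at hs
      field_simp at hs
      linear_combination -hs
    rcases mul_eq_zero.mp this with h0 | h0
    · exfalso; linarith
    · rw [eq_div_iff ht1.ne']; linarith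
  -- Since xt² = t - 1, the recurrence multiplied by the power of x telescopes.
  have hzx : ∀ n, z n * x ^ n =
      (t - ∑ j ∈ Finset.range (n + 1), (catalan j : ℝ) * x ^ j) / (t - 1) := by
    intro n
    induction n with
    | zero => simp [h.1, div_self ht1.ne']
    | succ n ih =>
      rw [Finset.sum_range_succ, ← sub_sub, sub_div, ← ih]
      have hr := h.recurrence n
      have hz : z (n + 1) = (t ^ 2 * z n - catalan (n + 1)) / (t - 1) := by
        rw [eq_div_iff ht1.ne', ← hr]; ring
      have hxt : x * t ^ 2 = t - 1 := by rw [hx]; field_simp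
      rw [hz, div_mul_eq_mul_div, sub_mul, sub_div]
      congr 1
      rw [div_eq_iff ht1.ne', ← hxt]; ring
  have hlim : Tendsto (fun n => z n * x ^ n) atTop (𝓝 (t * (t - 2) / (t - 1) ^ 2)) := by
    have h1 := ((tendsto_add_atTop_iff_nat 1).mpr hsum.tendsto_sum_nat)
    have h2 := (h1.const_sub t).div_const (t - 1)
    have e : (t - s) / (t - 1) = t * (t - 2) / (t - 1) ^ 2 := by
      rw [hs']; field_simp; ring
    rw [e] at h2
    exact h2.congr fun n => (hzx n).symm
  have h2 := (isEquivalent_const_iff_tendsto (by positivity)).mpr hlim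
  have h3 := h2.mul (IsEquivalent.refl (u := fun n : ℕ => (t ^ 2 / (t - 1)) ^ n) (l := atTop))
  refine (IsEquivalent.refl.congr_left (Eventually.of_forall fun n => ?_)).trans h3
  simp only [Pi.mul_apply]
  rw [mul_assoc, ← mul_pow, show x * (t ^ 2 / (t - 1)) = 1 by rw [hx]; field_simp, one_pow,
    mul_one]

/-! ### Gluing two permutations around one entry -/

theorem Fin.forall_block {k m : ℕ} {P : Fin (k + 1 + m) → Prop} :
    (∀ x, P x) ↔ (∀ i : Fin k, P (Fin.castAdd m i.castSucc)) ∧ P (Fin.castAdd m (Fin.last k)) ∧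
      ∀ j : Fin m, P (Fin.natAdd (k + 1) j) := by
  constructor
  · exact fun h => ⟨fun _ => h _, h _, fun _ => h _⟩
  · rintro ⟨h1, h2, h3⟩ x
    induction x using Fin.addCases with
    | left y =>
      induction y using Fin.lastCases with
      | last => exact h2
      | cast i => exact h1 i
    | right j => exact h3 j

theorem Fin.prod_univ_block {M : Type*} [CommMonoid M] {k m : ℕ} (f : Fin (k + 1 + m) → M) :
    ∏ x, f x = (∏ i : Fin k, f (Fin.castAdd m i.castSucc)) * f (Fin.castAdd m (Fin.last k)) *
      ∏ j : Fin m, f (Fin.natAdd (k + 1) j) := by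
  rw [Fin.prod_univ_add, Fin.prod_univ_castSucc]

theorem card_le_of_injective_lt {α : Type*} [Fintype α] {n : ℕ} (f : α → Fin n)
    (hf : Function.Injective f) {v : ℕ} (h : ∀ a, (f a : ℕ) < v) : Fintype.card α ≤ v := by
  have := Fintype.card_le_of_injective (fun a => (⟨f a, h a⟩ : Fin v)) fun a b hab =>
    hf (Fin.ext (by simpa using hab))
  simpa using this

theorem add_card_lt_of_injective_lt {α : Type*} [Fintype α] {n : ℕ} (f : α → Fin n)
    (hf : Function.Injective f) {v : ℕ} (hv : v < n) (h : ∀ a, v < (f a : ℕ)) :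
    v + Fintype.card α < n := by
  have := card_le_of_injective_lt (fun a => (f a).rev) (Fin.rev_injective.comp hf)
    (v := n - 1 - v) fun a => by
      have := h a
      have := (f a).isLt
      simp only [Fin.val_rev]
      omega
  omega

/-- The admissible value offsets for gluing permutations of lengths `k` and `m` around one middle
entry: the left block gets the values `a + _`, the middle entry the value `b`, and the right block
the values `c + _`; the left block is either below or above the right block. -/
def IsBlockOffset (k m a b c : ℕ) : Prop :=
  (a = 0 ∧ b = k ∧ c = k + 1) ∨ (a = m ∧ b = k + m ∧ c = 0)

section Glue

variable {k m a b c : ℕ}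

/-- The one-line notation of the glued permutation. -/
def glueFun (H : IsBlockOffset k m a b c) (L : Equiv.Perm (Fin k)) (R : Equiv.Perm (Fin m)) :
    Fin (k + 1 + m) → Fin (k + 1 + m) :=
  Fin.addCases
    (Fin.lastCases ⟨b, by unfold IsBlockOffset at H; omega⟩
      fun i => ⟨a + L i, by have := (L i).isLt; unfold IsBlockOffset at H; omega⟩)
    fun j => ⟨c + R j, by have := (R j).isLt; unfold IsBlockOffset at H; omega⟩

theorem glueFun_left (H : IsBlockOffset k m a b c) (L : Equiv.Perm (Fin k))
    (R : Equiv.Perm (Fin m)) (i : Fin k) :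
    (glueFun H L R (Fin.castAdd m i.castSucc) : ℕ) = a + L i := by
  simp [glueFun]

theorem glueFun_mid (H : IsBlockOffset k m a b c) (L : Equiv.Perm (Fin k))
    (R : Equiv.Perm (Fin m)) :
    (glueFun H L R (Fin.castAdd m (Fin.last k)) : ℕ) = b := by
  simp [glueFun]

theorem glueFun_right (H : IsBlockOffset k m a b c) (L : Equiv.Perm (Fin k))
    (R : Equiv.Perm (Fin m)) (j : Fin m) :
    (glueFun H L R (Fin.natAdd (k + 1) j) : ℕ) = c + R j := by
  simp [glueFun]

theorem glueFun_injective (H : IsBlockOffset k m a b c) (L : Equiv.Perm (Fin k))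
    (R : Equiv.Perm (Fin m)) : Function.Injective (glueFun H L R) := by
  unfold Function.Injective
  have hb := H
  unfold IsBlockOffset at hb
  simp only [Fin.forall_block, Fin.ext_iff (a := glueFun H L R _), glueFun_left, glueFun_mid,
    glueFun_right]
  have hL : ∀ i, (L i : ℕ) < k := fun i => (L i).isLt
  have hR : ∀ i, (R i : ℕ) < m := fun i => (R i).isLt
  refine ⟨fun i => ⟨fun j h => ?_, fun h => ?_, fun j h => ?_⟩,
    ⟨fun j h => ?_, fun h => ?_, fun j h => ?_⟩,
    fun i => ⟨fun j h => ?_, fun h => ?_, fun j h => ?_⟩⟩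
  · rw [L.injective (Fin.ext (Nat.add_left_cancel h))]
  · have := hL i; omega
  · have := hL i; have := hR j; omega
  · have := hL j; omega
  · trivial
  · have := hR j; omega
  · have := hL j; have := hR i; omega
  · have := hR i; omega
  · rw [R.injective (Fin.ext (Nat.add_left_cancel h))]

/-- The permutation of length `k + 1 + m` made of `L`, one middle entry, and `R`. -/
noncomputable def glue (H : IsBlockOffset k m a b c) (L : Equiv.Perm (Fin k))
    (R : Equiv.Perm (Fin m)) : Equiv.Perm (Fin (k + 1 + m)) :=
  Equiv.ofBijective _ (Finite.injective_iff_bijective.mp (glueFun_injective H L R))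

theorem glue_left (H : IsBlockOffset k m a b c) (L : Equiv.Perm (Fin k))
    (R : Equiv.Perm (Fin m)) (i : Fin k) :
    (glue H L R (Fin.castAdd m i.castSucc) : ℕ) = a + L i := glueFun_left H L R i

theorem glue_mid (H : IsBlockOffset k m a b c) (L : Equiv.Perm (Fin k))
    (R : Equiv.Perm (Fin m)) :
    (glue H L R (Fin.castAdd m (Fin.last k)) : ℕ) = b := glueFun_mid H L R

theorem glue_right (H : IsBlockOffset k m a b c) (L : Equiv.Perm (Fin k))
    (R : Equiv.Perm (Fin m)) (j : Fin m) :
    (glue H L R (Fin.natAdd (k + 1) j) : ℕ) = c + R j := glueFun_right H L R j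

theorem glue_injective (H : IsBlockOffset k m a b c) {L L' : Equiv.Perm (Fin k)}
    {R R' : Equiv.Perm (Fin m)} (h : glue H L R = glue H L' R') : L = L' ∧ R = R' := by
  constructor
  · ext i
    have := glue_left H L R i
    rw [h, glue_left] at this
    omega
  · ext i
    have := glue_right H L R i
    rw [h, glue_right] at this
    omega

theorem exists_perm_of_offset {p n e : ℕ} (f : Fin p → Fin n) (hf : Function.Injective f)
    (h : ∀ i, e ≤ f i ∧ (f i : ℕ) < e + p) :
    ∃ L : Equiv.Perm (Fin p), ∀ i, (f i : ℕ) = e + L i := by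
  let g : Fin p → Fin p := fun i => ⟨f i - e, by have := h i; omega⟩
  have hg : Function.Injective g := by
    intro i j hij
    have h1 : (f i : ℕ) - e = f j - e := congrArg Fin.val hij
    have := h i
    have := h j
    exact hf (Fin.ext (by omega))
  refine ⟨Equiv.ofBijective g (Finite.injective_iff_bijective.mp hg), fun i => ?_⟩
  have := h i
  change (f i : ℕ) = e + (f i - e)
  omega

theorem exists_eq_glue (H : IsBlockOffset k m a b c) (σ : Equiv.Perm (Fin (k + 1 + m)))
    (hl : ∀ i : Fin k, a ≤ σ (Fin.castAdd m i.castSucc) ∧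
      (σ (Fin.castAdd m i.castSucc) : ℕ) < a + k)
    (hm : (σ (Fin.castAdd m (Fin.last k)) : ℕ) = b)
    (hr : ∀ j : Fin m, c ≤ σ (Fin.natAdd (k + 1) j) ∧ (σ (Fin.natAdd (k + 1) j) : ℕ) < c + m) :
    ∃ L R, glue H L R = σ := by
  obtain ⟨L, hL⟩ := exists_perm_of_offset (fun i : Fin k => σ (Fin.castAdd m i.castSucc))
    (fun i j h => by simpa using h) hl
  obtain ⟨R, hR⟩ := exists_perm_of_offset (fun j : Fin m => σ (Fin.natAdd (k + 1) j))
    (fun i j h => by simpa using h) hr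
  refine ⟨L, R, Equiv.ext (Fin.forall_block.mpr ⟨fun i => Fin.ext ?_, Fin.ext ?_, fun j =>
    Fin.ext ?_⟩)⟩
  · rw [glue_left, hL]
  · rw [glue_mid, hm]
  · rw [glue_right, hR]

/-- A sum over a set of permutations which are all glued, with the two parts ranging over given
sets, factors through the parts. -/
theorem sum_glue {M : Type*} [AddCommMonoid M] (H : IsBlockOffset k m a b c)
    (S : Finset (Equiv.Perm (Fin (k + 1 + m))))
    (A : Finset (Equiv.Perm (Fin k))) (B : Finset (Equiv.Perm (Fin m)))
    (hS : ∀ L R, glue H L R ∈ S ↔ L ∈ A ∧ R ∈ B) (hsurj : ∀ σ ∈ S, ∃ L R, glue H L R = σ)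
    (w : Equiv.Perm (Fin (k + 1 + m)) → M) :
    ∑ σ ∈ S, w σ = ∑ L ∈ A, ∑ R ∈ B, w (glue H L R) := by
  rw [← Finset.sum_product']
  symm
  refine Finset.sum_bij (fun p _ => glue H p.1 p.2) ?_ ?_ ?_ fun _ _ => rfl
  · exact fun p hp => (hS _ _).mpr (Finset.mem_product.mp hp)
  · exact fun p _ p' _ h => Prod.ext (glue_injective H h).1 (glue_injective H h).2
  · intro σ hσ
    obtain ⟨L, R, rfl⟩ := hsurj σ hσ
    exact ⟨(L, R), Finset.mem_product.mpr ((hS _ _).mp hσ), rfl⟩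

end Glue

/-! ### The three patterns and the symmetry between 213 and 132 -/

theorem containsPattern_three {n : ℕ} (σ : Equiv.Perm (Fin n)) (τ : Equiv.Perm (Fin 3)) :
    ContainsPattern σ τ ↔ ∃ x y z : Fin n, x < y ∧ y < z ∧ (σ x < σ y ↔ τ 0 < τ 1) ∧
      (σ x < σ z ↔ τ 0 < τ 2) ∧ (σ y < σ z ↔ τ 1 < τ 2) := by
  constructor
  · rintro ⟨i, hi, h⟩
    exact ⟨i 0, i 1, i 2, hi (by decide), hi (by decide), h _ _, h _ _, h _ _⟩
  · rintro ⟨x, y, z, hxy, hyz, h1, h2, h3⟩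
    have hxz := hxy.trans hyz
    have flip : ∀ {u v : Fin n} {r s : Fin 3}, u ≠ v → r ≠ s → (σ u < σ v ↔ τ r < τ s) →
        (σ v < σ u ↔ τ s < τ r) := by
      intro u v r s huv hrs h
      have h1 : σ u ≠ σ v := fun h => huv (σ.injective h)
      have h2 : τ r ≠ τ s := fun h => hrs (τ.injective h)
      rw [← not_iff_not, not_lt, not_lt, h1.le_iff_lt, h2.le_iff_lt, h]
    refine ⟨![x, y, z], ?_, ?_⟩
    · rw [Fin.strictMono_iff_lt_succ]
      intro i
      fin_cases i
      · exact hxy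
      · exact hyz
    · intro j k
      fin_cases j <;> fin_cases k
      · simp
      · exact h1
      · exact h2
      · exact flip hxy.ne (by decide) h1
      · simp
      · exact h3
      · exact flip hxz.ne (by decide) h2
      · exact flip hyz.ne (by decide) h3
      · simp

theorem mem_avoidingPerms {n m : ℕ} {σ : Equiv.Perm (Fin n)} {τ : Equiv.Perm (Fin m)} :
    σ ∈ avoidingPerms n τ ↔ ¬ ContainsPattern σ τ := by
  simp [avoidingPerms]

theorem mem_avoidingPerms_132 {n : ℕ} {σ : Equiv.Perm (Fin n)} :
    σ ∈ avoidingPerms n pattern132 ↔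
      ∀ x y z : Fin n, x < y → y < z → σ x < σ z → ¬ σ z < σ y := by
  rw [mem_avoidingPerms, containsPattern_three]
  have e1 : pattern132 0 < pattern132 1 := by decide
  have e2 : pattern132 0 < pattern132 2 := by decide
  have e3 : ¬ pattern132 1 < pattern132 2 := by decide
  simp only [e1, e2, e3, iff_true, iff_false]
  constructor
  · intro h x y z hxy hyz h1 h2
    exact h ⟨x, y, z, hxy, hyz, h1.trans h2, h1, h2.not_gt⟩
  · rintro h ⟨x, y, z, hxy, hyz, h1, h2, h3⟩
    exact h x y z hxy hyz h2 (lt_of_le_of_ne (not_lt.mp h3) fun e => hyz.ne' (σ.injective e))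

theorem mem_avoidingPerms_213 {n : ℕ} {σ : Equiv.Perm (Fin n)} :
    σ ∈ avoidingPerms n pattern213 ↔
      ∀ x y z : Fin n, x < y → y < z → σ y < σ x → ¬ σ x < σ z := by
  rw [mem_avoidingPerms, containsPattern_three]
  have e1 : ¬ pattern213 0 < pattern213 1 := by decide
  have e2 : pattern213 0 < pattern213 2 := by decide
  have e3 : pattern213 1 < pattern213 2 := by decide
  simp only [e1, e2, e3, iff_true, iff_false]
  constructor
  · intro h x y z hxy hyz h1 h2
    exact h ⟨x, y, z, hxy, hyz, h1.not_gt, h2, h1.trans h2⟩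
  · rintro h ⟨x, y, z, hxy, hyz, h1, h2, h3⟩
    exact h x y z hxy hyz (lt_of_le_of_ne (not_lt.mp h1) fun e => hxy.ne' (σ.injective e)) h2

theorem mem_avoidingPerms_321 {n : ℕ} {σ : Equiv.Perm (Fin n)} :
    σ ∈ avoidingPerms n pattern321 ↔
      ∀ x y z : Fin n, x < y → y < z → σ y < σ x → ¬ σ z < σ y := by
  rw [mem_avoidingPerms, containsPattern_three]
  have e1 : ¬ pattern321 0 < pattern321 1 := by decide
  have e2 : ¬ pattern321 0 < pattern321 2 := by decide
  have e3 : ¬ pattern321 1 < pattern321 2 := by decide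
  simp only [e1, e2, e3, iff_false]
  constructor
  · intro h x y z hxy hyz h1 h2
    exact h ⟨x, y, z, hxy, hyz, h1.not_gt, (h2.trans h1).not_gt, h2.not_gt⟩
  · rintro h ⟨x, y, z, hxy, hyz, h1, h2, h3⟩
    exact h x y z hxy hyz (lt_of_le_of_ne (not_lt.mp h1) fun e => hxy.ne' (σ.injective e))
      (lt_of_le_of_ne (not_lt.mp h3) fun e => hyz.ne' (σ.injective e))

theorem avoidingZ_eq_sum_prod {n : ℕ} (q : ℝ) {m : ℕ} (τ : Equiv.Perm (Fin m)) :
    avoidingZ n q τ = ∑ σ ∈ avoidingPerms n τ, ∏ i, if σ i = i then q else 1 := by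
  refine Finset.sum_congr rfl fun σ _ => ?_
  rw [Finset.prod_ite, Finset.prod_const, Finset.prod_const_one, mul_one]
  rfl

theorem rev_conj_mem_avoidingPerms_132 {n : ℕ} {σ : Equiv.Perm (Fin n)} :
    Fin.revPerm * σ * Fin.revPerm ∈ avoidingPerms n pattern132 ↔
      σ ∈ avoidingPerms n pattern213 := by
  rw [mem_avoidingPerms_132, mem_avoidingPerms_213]
  simp only [Equiv.Perm.mul_apply, Fin.revPerm_apply, Fin.rev_lt_rev]
  constructor
  · intro h x y z hxy hyz h1 h2
    exact h z.rev y.rev x.rev (by simpa) (by simpa) (by simpa) (by simpa)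
  · intro h x y z hxy hyz h1 h2
    exact h z.rev y.rev x.rev (by simpa) (by simpa) h2 h1

/-- Reverse-complement is conjugation by `Fin.revPerm`, so it maps fixed points to fixed points, and
it exchanges the two patterns. -/
theorem avoidingZ_213 (n : ℕ) (q : ℝ) : avoidingZ n q pattern213 = avoidingZ n q pattern132 := by
  rw [avoidingZ_eq_sum_prod, avoidingZ_eq_sum_prod]
  have hinv : ∀ σ : Equiv.Perm (Fin n),
      Fin.revPerm * (Fin.revPerm * σ * Fin.revPerm) * Fin.revPerm = σ := by
    intro σ; ext i; simp
  refine Finset.sum_bij (fun σ _ => Fin.revPerm * σ * Fin.revPerm) ?_ ?_ ?_ ?_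
  · exact fun σ hσ => rev_conj_mem_avoidingPerms_132.mpr hσ
  · intro σ _ σ' _ h
    rw [← hinv σ, h, hinv]
  · intro σ hσ
    exact ⟨Fin.revPerm * σ * Fin.revPerm, rev_conj_mem_avoidingPerms_132.mp (by rwa [hinv]),
      hinv σ⟩
  · intro σ _
    refine Fintype.prod_equiv Fin.revPerm _ _ fun i => ?_
    simp

/-! ### Fixed points of 321-avoiding permutations -/

theorem isBlockOffset_directSum (k m : ℕ) : IsBlockOffset k m 0 k (k + 1) := Or.inl ⟨rfl, rfl, rfl⟩

theorem glue_directSum_mem_321 {k m : ℕ} (L : Equiv.Perm (Fin k)) (R : Equiv.Perm (Fin m)) :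
    glue (isBlockOffset_directSum k m) L R ∈ avoidingPerms _ pattern321 ↔
      L ∈ avoidingPerms k pattern321 ∧ R ∈ avoidingPerms m pattern321 := by
  have hL : ∀ i, (L i : ℕ) < k := fun i => (L i).isLt
  have hR : ∀ i, (R i : ℕ) < m := fun i => (R i).isLt
  simp only [mem_avoidingPerms_321]
  simp only [Fin.forall_block, Fin.lt_def, glue_left, glue_mid, glue_right, Fin.val_castAdd,
    Fin.val_castSucc, Fin.val_natAdd, Fin.val_last]
  constructor
  · intro h
    refine ⟨fun x y z hxy hyz h1 h2 => (((h.1 x).1 y).1 z) hxy hyz (by omega) (by omega),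
      fun x y z hxy hyz h1 h2 => (((h.2.2 x).2.2 y).2.2 z) (by omega) (by omega) (by omega)
        (by omega)⟩
  · rintro ⟨h1, h2⟩
    refine ⟨fun x => ⟨fun y => ⟨fun z => ?_, ?_, fun z => ?_⟩, ⟨fun z => ?_, ?_, fun z => ?_⟩,
      fun y => ⟨fun z => ?_, ?_, fun z => ?_⟩⟩,
      ⟨fun y => ⟨fun z => ?_, ?_, fun z => ?_⟩, ⟨fun z => ?_, ?_, fun z => ?_⟩,
      fun y => ⟨fun z => ?_, ?_, fun z => ?_⟩⟩,
      fun x => ⟨fun y => ⟨fun z => ?_, ?_, fun z => ?_⟩, ⟨fun z => ?_, ?_, fun z => ?_⟩,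
      fun y => ⟨fun z => ?_, ?_, fun z => ?_⟩⟩⟩
    · intro hxy hyz a b
      exact h1 x y z hxy hyz (by omega) (by omega)
    all_goals try (have hx1 := hL x)
    all_goals try (have hx2 := hR x)
    all_goals try (have hy1 := hL y)
    all_goals try (have hy2 := hR y)
    all_goals try (have hz1 := hL z)
    all_goals try (have hz2 := hR z)
    all_goals try omega
    intro hxy hyz a b
    exact h2 x y z (by omega) (by omega) (by omega) (by omega)

/-- A fixed point of a `321`-avoiding permutation splits it into a direct sum. -/
theorem exists_glue_of_fixed_321 {k m : ℕ} {σ : Equiv.Perm (Fin (k + 1 + m))}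
    (hσ : σ ∈ avoidingPerms _ pattern321)
    (hfix : σ (Fin.castAdd m (Fin.last k)) = Fin.castAdd m (Fin.last k)) :
    ∃ L R, glue (isBlockOffset_directSum k m) L R = σ := by
  rw [mem_avoidingPerms_321] at hσ
  have hval : (σ (Fin.castAdd m (Fin.last k)) : ℕ) = k := by rw [hfix]; simp
  have hnel : ∀ i : Fin k, (σ (Fin.castAdd m i.castSucc) : ℕ) ≠ k := by
    intro i h
    have := congrArg Fin.val (σ.injective (Fin.ext (h.trans hval.symm)))
    simp at this
    omega
  have hner : ∀ j : Fin m, (σ (Fin.natAdd (k + 1) j) : ℕ) ≠ k := by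
    intro j h
    have := congrArg Fin.val (σ.injective (Fin.ext (h.trans hval.symm)))
    simp at this
    omega
  have hlr : ∀ (i : Fin k) (j : Fin m), k < (σ (Fin.castAdd m i.castSucc) : ℕ) →
      (σ (Fin.natAdd (k + 1) j) : ℕ) < k → False := by
    intro i j h1 h2
    refine hσ (Fin.castAdd m i.castSucc) (Fin.castAdd m (Fin.last k)) (Fin.natAdd (k + 1) j)
      ?_ ?_ ?_ ?_ <;> simp only [Fin.lt_def, Fin.val_castAdd, Fin.val_castSucc, Fin.val_natAdd,
        Fin.val_last, hval] <;> omega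
  have hl : ∀ i : Fin k, (σ (Fin.castAdd m i.castSucc) : ℕ) < k := by
    intro i
    by_contra hcon
    have hgt : k < (σ (Fin.castAdd m i.castSucc) : ℕ) := by have := hnel i; omega
    -- If a left entry exceeds k, `hlr` forces all m right entries above k as well, which puts m + 1
    -- entries into the m values above k.
    have := add_card_lt_of_injective_lt (v := k)
      (fun x : Unit ⊕ Fin m => σ (Sum.elim (fun _ => Fin.castAdd m i.castSucc)
        (Fin.natAdd (k + 1)) x))
      (σ.injective.comp (Function.Injective.sumElim (fun _ _ _ => rfl)
        (fun _ _ h => by simpa using h) fun _ j h => by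
          have := congrArg Fin.val h; simp at this; omega))
      (by omega) (by
        rintro (_ | j)
        · exact hgt
        · have h1 := hner j
          have h2 := hlr i j hgt
          simp only [Sum.elim_inr]
          by_contra hc
          exact h2 (by omega))
    rw [Fintype.card_sum, Fintype.card_unit, Fintype.card_fin] at this
    omega
  have hr : ∀ j : Fin m, k < (σ (Fin.natAdd (k + 1) j) : ℕ) := by
    intro j
    by_contra hcon
    have hlt : (σ (Fin.natAdd (k + 1) j) : ℕ) < k := by have := hner j; omega
    -- All k left entries and one right entry would share the k values below k.
    have := card_le_of_injective_lt (v := k)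
      (fun x : Unit ⊕ Fin k => σ (Sum.elim (fun _ => Fin.natAdd (k + 1) j)
        (fun i => Fin.castAdd m i.castSucc) x))
      (σ.injective.comp (Function.Injective.sumElim (fun _ _ _ => rfl)
        (fun _ _ h => by simpa using h) fun _ i h => by
          have := congrArg Fin.val h; simp at this; omega))
      (by
        rintro (_ | i)
        · exact hlt
        · exact hl i)
    rw [Fintype.card_sum, Fintype.card_unit, Fintype.card_fin] at this
    omega
  refine exists_eq_glue _ σ (fun i => ⟨Nat.zero_le _, by simpa using hl i⟩) hval
    fun j => ⟨hr j, ?_⟩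
  have := (σ (Fin.natAdd (k + 1) j)).isLt
  omega

/-- The weight only sees positions before the fixed point, so the left summand is weighted and the
right one is merely counted. -/
theorem sum_fixed_321 {n k m : ℕ} (h : k + 1 + m = n) (x : Fin n) (hx : (x : ℕ) = k) (q : ℝ) :
    ∑ σ ∈ (avoidingPerms n pattern321).filter (fun σ => σ x = x),
      ∏ j ∈ Finset.univ.filter (fun j => j < x), (if σ j = j then q else 1) =
    avoidingZ k q pattern321 * (avoidingPerms m pattern321).card := by
  subst h
  obtain rfl : x = Fin.castAdd m (Fin.last k) := Fin.ext (by simpa using hx)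
  rw [sum_glue (isBlockOffset_directSum k m) _ (avoidingPerms k pattern321)
    (avoidingPerms m pattern321), avoidingZ_eq_sum_prod, Finset.sum_mul]
  · refine Finset.sum_congr rfl fun L _ => ?_
    rw [Finset.sum_congr rfl (g := fun _ => ∏ i, if L i = i then q else 1), Finset.sum_const,
      nsmul_eq_mul, mul_comm]
    intro R _
    rw [Finset.prod_filter, Fin.prod_univ_block]
    simp only [Fin.lt_def, Fin.ext_iff, glue_left, glue_mid, glue_right, Fin.val_castAdd,
      Fin.val_castSucc, Fin.val_natAdd, Fin.val_last]
    have hone : ∏ j : Fin m, (if k + 1 + (j : ℕ) < k then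
        if k + 1 + (R j : ℕ) = k + 1 + j then q else 1 else 1) = 1 :=
      Finset.prod_eq_one fun j _ => if_neg (by omega)
    rw [if_neg (lt_irrefl k), hone, mul_one, mul_one]
    refine Finset.prod_congr rfl fun i _ => ?_
    rw [if_pos i.isLt, zero_add]
  · intro L R
    rw [Finset.mem_filter, glue_directSum_mem_321, Fin.ext_iff, glue_mid]
    simp
  · intro σ hσ
    rw [Finset.mem_filter] at hσ
    exact exists_glue_of_fixed_321 hσ.1 hσ.2

theorem avoidingZ_321_expand (n : ℕ) (q : ℝ) :
    avoidingZ (n + 1) q pattern321 = (avoidingPerms (n + 1) pattern321).card + (q - 1) *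
      ∑ p ∈ Finset.HasAntidiagonal.antidiagonal n,
        ((avoidingPerms p.1 pattern321).card : ℝ) * avoidingZ p.2 q pattern321 := by
  have e : ∀ σ : Equiv.Perm (Fin (n + 1)), (∏ i, if σ i = i then q else 1) =
      1 + ∑ i, (if σ i = i then (q - 1) * ∏ j ∈ Finset.univ.filter (fun j => j < i),
        (if σ j = j then q else 1) else 0) := by
    intro σ
    have e1 : ∀ i, (if σ i = i then q else 1) = 1 + (if σ i = i then q - 1 else 0) := by
      intro i; split_ifs <;> ring
    simp only [e1]
    -- Expands the product by the largest index at which the summand q - 1 is chosen; the factors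
    -- before it stay intact and those after it contribute 1.
    rw [Finset.prod_one_add_ordered]
    simp only [ite_mul, zero_mul]
  rw [avoidingZ_eq_sum_prod, Finset.sum_congr rfl fun σ _ => e σ, Finset.sum_add_distrib,
    Finset.sum_const, nsmul_one, Finset.sum_comm]
  congr 1
  have e2 : ∀ i : Fin (n + 1), ∑ σ ∈ avoidingPerms (n + 1) pattern321,
      (if σ i = i then (q - 1) * ∏ j ∈ Finset.univ.filter (fun j => j < i),
        (if σ j = j then q else 1) else 0) =
      (q - 1) * (avoidingZ i q pattern321 * (avoidingPerms (n - i) pattern321).card) := by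
    intro i
    rw [← Finset.sum_filter, ← Finset.mul_sum, sum_fixed_321 (m := n - i) (by omega) i rfl]
  rw [Finset.sum_congr rfl fun i _ => e2 i, ← Finset.mul_sum,
    Fin.sum_univ_eq_sum_range
      (fun i => avoidingZ i q pattern321 * ((avoidingPerms (n - i) pattern321).card : ℝ)),
    ← Finset.Nat.sum_antidiagonal_eq_sum_range_succ
      (fun i j => avoidingZ i q pattern321 * ((avoidingPerms j pattern321).card : ℝ)),
    ← Finset.Nat.sum_antidiagonal_swap]
  congr 1
  exact Finset.sum_congr rfl fun p _ => mul_comm _ _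

/-! ### Counting 321-avoiders by their first entry -/

/-- The permutation with first entry `j` whose remaining entries are order isomorphic to `σ`. -/
def consPerm {n : ℕ} (j : Fin (n + 1)) (σ : Equiv.Perm (Fin n)) : Equiv.Perm (Fin (n + 1)) :=
  (finSuccEquiv n).trans ((Equiv.optionCongr σ).trans (finSuccEquiv' j).symm)

theorem consPerm_zero {n : ℕ} (j : Fin (n + 1)) (σ : Equiv.Perm (Fin n)) :
    consPerm j σ 0 = j := by simp [consPerm]

theorem consPerm_succ {n : ℕ} (j : Fin (n + 1)) (σ : Equiv.Perm (Fin n)) (i : Fin n) :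
    consPerm j σ i.succ = j.succAbove (σ i) := by simp [consPerm]

theorem exists_eq_consPerm {n : ℕ} (σ : Equiv.Perm (Fin (n + 1))) :
    ∃ j ρ, consPerm j ρ = σ := by
  have h : ∀ i : Fin n, ∃ v, (σ 0).succAbove v = σ i.succ := fun i =>
    Fin.exists_succAbove_eq fun h => Fin.succ_ne_zero i (σ.injective h)
  choose g hg using h
  have hinj : Function.Injective g := fun a b hab => by
    have : σ a.succ = σ b.succ := by rw [← hg, ← hg, hab]
    simpa using this
  refine ⟨σ 0, Equiv.ofBijective g (Finite.injective_iff_bijective.mp hinj), Equiv.ext fun i => ?_⟩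
  induction i using Fin.cases with
  | zero => exact consPerm_zero _ _
  | succ i => rw [consPerm_succ]; exact hg i

theorem consPerm_injective {n : ℕ} {j j' : Fin (n + 1)} {σ σ' : Equiv.Perm (Fin n)}
    (h : consPerm j σ = consPerm j' σ') : j = j' ∧ σ = σ' := by
  have hj : j = j' := by rw [← consPerm_zero j σ, h, consPerm_zero]
  subst hj
  refine ⟨rfl, Equiv.ext fun i => j.succAbove_right_injective ?_⟩
  rw [← consPerm_succ, h, consPerm_succ]

/-- The values of `σ` below `k` appear in increasing order. -/
def IncreasingBelow {n : ℕ} (k : ℕ) (σ : Equiv.Perm (Fin n)) : Prop :=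
  ∀ x y : Fin n, x < y → (σ x : ℕ) < k → ¬ σ y < σ x

open Classical in
/-- The `321`-avoiding permutations whose values below `k` appear in increasing order. -/
noncomputable def avoidingIncreasing (n k : ℕ) : Finset (Equiv.Perm (Fin n)) :=
  (avoidingPerms n pattern321).filter (IncreasingBelow k)

theorem mem_avoidingIncreasing {n k : ℕ} {σ : Equiv.Perm (Fin n)} :
    σ ∈ avoidingIncreasing n k ↔ σ ∈ avoidingPerms n pattern321 ∧ IncreasingBelow k σ := by
  simp [avoidingIncreasing]

theorem avoidingPerms_321_zero : avoidingPerms 0 pattern321 = Finset.univ :=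
  Finset.eq_univ_iff_forall.mpr fun _ => mem_avoidingPerms_321.mpr fun x => x.elim0

theorem avoidingIncreasing_zero (n : ℕ) :
    avoidingIncreasing n 0 = avoidingPerms n pattern321 := by
  ext σ
  simp [mem_avoidingIncreasing, IncreasingBelow]

theorem succAbove_val_cases {n : ℕ} (j : Fin (n + 1)) (x : Fin n) :
    ((x : ℕ) < j ∧ (j.succAbove x : ℕ) = x) ∨ ((j : ℕ) ≤ x ∧ (j.succAbove x : ℕ) = x + 1) := by
  rcases lt_or_ge (x : ℕ) j with h | h
  · left
    rw [Fin.succAbove_of_castSucc_lt _ _ (by simpa [Fin.lt_def] using h)]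
    exact ⟨h, rfl⟩
  · right
    rw [Fin.succAbove_of_le_castSucc _ _ (by simpa [Fin.le_def] using h)]
    exact ⟨h, rfl⟩

/-- A new first entry j can only play the role of 3, so it creates a 321 exactly when two values
below j form an inversion. -/
theorem consPerm_mem_321 {n : ℕ} (j : Fin (n + 1)) (σ : Equiv.Perm (Fin n)) :
    consPerm j σ ∈ avoidingPerms _ pattern321 ↔ σ ∈ avoidingIncreasing n j := by
  rw [mem_avoidingIncreasing, mem_avoidingPerms_321, mem_avoidingPerms_321]
  simp only [Fin.forall_fin_succ, consPerm_zero, consPerm_succ, Fin.succ_lt_succ_iff,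
    Fin.succAbove_lt_succAbove_iff, Fin.not_lt_zero, false_imp_iff, imp_true_iff, true_and,
    Fin.succ_pos, true_imp_iff, IncreasingBelow]
  rw [and_comm]
  refine and_congr Iff.rfl ?_
  refine forall_congr' fun x => forall_congr' fun y => imp_congr Iff.rfl (imp_congr ?_ Iff.rfl)
  have := succAbove_val_cases j (σ x)
  rw [Fin.lt_def]
  omega

/-- A first entry 0 raises all other values by one, so the threshold drops to k. A first entry in 1,
…, k precedes the smaller value 0, which is forbidden. For a larger j, order below j already implies
order below k + 1. -/
theorem consPerm_mem_avoidingIncreasing {n : ℕ} (j : Fin (n + 1)) (σ : Equiv.Perm (Fin n)) (k : ℕ) :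
    consPerm j σ ∈ avoidingIncreasing (n + 1) (k + 1) ↔
      ((j : ℕ) = 0 ∧ σ ∈ avoidingIncreasing n k) ∨
        (k + 1 ≤ (j : ℕ) ∧ σ ∈ avoidingIncreasing n j) := by
  rw [mem_avoidingIncreasing, consPerm_mem_321]
  have e : IncreasingBelow (k + 1) (consPerm j σ) ↔
      ((j : ℕ) < k + 1 → ∀ y, ¬ j.succAbove (σ y) < j) ∧
      ∀ x y : Fin n, x < y → (j.succAbove (σ x) : ℕ) < k + 1 → ¬ σ y < σ x := by
    constructor
    · intro h
      refine ⟨fun hj y => ?_, fun x y hxy hx => ?_⟩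
      · simpa only [consPerm_zero, consPerm_succ] using
          h 0 y.succ y.succ_pos (by rwa [consPerm_zero])
      · simpa only [consPerm_succ, Fin.succAbove_lt_succAbove_iff] using
          h x.succ y.succ (Fin.succ_lt_succ_iff.mpr hxy) (by rwa [consPerm_succ])
    · rintro ⟨h1, h2⟩ x y hxy hx
      induction y using Fin.cases with
      | zero => exact absurd hxy (Fin.not_lt_zero x)
      | succ y =>
        induction x using Fin.cases with
        | zero =>
          rw [consPerm_zero] at hx ⊢
          rw [consPerm_succ]
          exact h1 hx y
        | succ x =>
          rw [consPerm_succ] at hx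
          rw [consPerm_succ, consPerm_succ, Fin.succAbove_lt_succAbove_iff]
          exact h2 x y (Fin.succ_lt_succ_iff.mp hxy) hx
  rw [e]
  rcases Nat.eq_zero_or_pos j with h0 | h0
  · have hj : j = 0 := Fin.ext h0
    subst hj
    simp only [mem_avoidingIncreasing, IncreasingBelow, Fin.succAbove_zero, Fin.val_succ,
      Fin.not_lt_zero, Fin.val_zero]
    simp
  · by_cases hjk : k + 1 ≤ (j : ℕ)
    · simp only [mem_avoidingIncreasing, IncreasingBelow, hjk, true_and]
      constructor
      · rintro ⟨h1, -⟩
        exact Or.inr h1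
      · rintro (⟨h, -⟩ | h)
        · omega
        · refine ⟨h, fun h => by omega, fun x y hxy hx => h.2 x y hxy ?_⟩
          have := succAbove_val_cases j (σ x)
          omega
    · constructor
      · rintro ⟨-, h, -⟩
        exfalso
        have hn : 0 < n := by have := j.isLt; omega
        -- The offending position is that of the value 0, which stays 0 since j > 0.
        refine h (by omega) (σ.symm ⟨0, hn⟩) ?_
        rw [Equiv.apply_symm_apply, Fin.lt_def]
        have := succAbove_val_cases j ⟨0, hn⟩
        simp only at this
        omega
      · rintro (⟨h, -⟩ | ⟨h, -⟩)
        · omega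
        · exact absurd h hjk

theorem card_eq_sum_consPerm {n : ℕ} (S : Finset (Equiv.Perm (Fin (n + 1))))
    (T : Fin (n + 1) → Finset (Equiv.Perm (Fin n))) (h : ∀ j σ, consPerm j σ ∈ S ↔ σ ∈ T j) :
    S.card = ∑ j, (T j).card := by
  rw [← Finset.card_sigma]
  symm
  refine Finset.card_bij (fun p _ => consPerm p.1 p.2) ?_ ?_ ?_
  · exact fun p hp => (h _ _).mpr (Finset.mem_sigma.mp hp).2
  · rintro ⟨j, σ⟩ _ ⟨j', σ'⟩ _ hp
    obtain ⟨rfl, rfl⟩ := consPerm_injective hp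
    rfl
  · intro σ hσ
    obtain ⟨j, ρ, rfl⟩ := exists_eq_consPerm σ
    exact ⟨⟨j, ρ⟩, Finset.mem_sigma.mpr ⟨Finset.mem_univ _, (h _ _).mp hσ⟩, rfl⟩

theorem card_avoidingIncreasing (n k : ℕ) (hk : k ≤ n) :
    ((avoidingIncreasing n k).card : ℝ) = ballot n k := by
  induction n generalizing k with
  | zero =>
    obtain rfl : k = 0 := by omega
    rw [avoidingIncreasing_zero, avoidingPerms_321_zero, ballot_zero_right]
    simp
  | succ n ih =>
    have hsum : ∀ k, k ≤ n → ∑ j : Fin (n + 1), (if k ≤ (j : ℕ) then ballot n j else 0) =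
        ballot (n + 1) (k + 1) := by
      intro k hk
      rw [← sum_Icc_ballot hk, Fin.sum_univ_eq_sum_range (fun j => if k ≤ j then ballot n j else 0),
        ← Finset.sum_filter]
      refine Finset.sum_congr ?_ fun _ _ => rfl
      ext j
      simp only [Finset.mem_filter, Finset.mem_range, Finset.mem_Icc]
      omega
    cases k with
    | zero =>
      rw [avoidingIncreasing_zero, card_eq_sum_consPerm _ (fun j => avoidingIncreasing n j)
        consPerm_mem_321, ← ballot_succ_one, ← hsum 0 (Nat.zero_le _)]
      push_cast
      exact Finset.sum_congr rfl fun j _ => by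
        rw [ih _ (by omega), if_pos (Nat.zero_le _)]
    | succ k =>
      have hk' : k ≤ n := by omega
      rw [card_eq_sum_consPerm _ (fun j => if (j : ℕ) = 0 then avoidingIncreasing n k else
        if k + 1 ≤ (j : ℕ) then avoidingIncreasing n j else ∅)]
      · push_cast
        have hl : ∀ j : Fin (n + 1), (((if (j : ℕ) = 0 then avoidingIncreasing n k else
            if k + 1 ≤ (j : ℕ) then avoidingIncreasing n j else ∅).card : ℕ) : ℝ) =
            (if j = 0 then ballot n k else 0) + if k + 1 ≤ (j : ℕ) then ballot n j else 0 := by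
          intro j
          rw [← ih k hk', ← ih j (by omega)]
          have : (j : ℕ) = 0 ↔ j = 0 := Fin.val_eq_zero_iff
          simp only [← this]
          split_ifs <;> first | omega | simp
        -- The contribution of first entry 0 is exactly the term j = k that the sum over j ≥ k + 1
        -- lacks.
        have hr : ∀ j : Fin (n + 1), (if k ≤ (j : ℕ) then ballot n j else 0) =
            (if j = ⟨k, by omega⟩ then ballot n k else 0) +
              if k + 1 ≤ (j : ℕ) then ballot n j else 0 := by
          intro j
          simp only [Fin.ext_iff]
          by_cases hjk : (j : ℕ) = k
          · rw [if_pos hjk.ge, if_pos hjk, if_neg (by omega), add_zero, hjk]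
          · rw [if_neg hjk, zero_add]
            split_ifs <;> first | rfl | omega
        rw [← hsum k hk', Finset.sum_congr rfl fun j _ => hl j,
          Finset.sum_congr rfl fun j _ => hr j, Finset.sum_add_distrib, Finset.sum_add_distrib,
          Finset.sum_ite_eq', Finset.sum_ite_eq', if_pos (Finset.mem_univ _),
          if_pos (Finset.mem_univ _)]
      · intro j σ
        rw [consPerm_mem_avoidingIncreasing j σ k]
        split_ifs with h1 h2
        · simp [h1]
        · simp [h1, h2]
        · simp [h1, h2]

theorem card_avoidingPerms_321 (n : ℕ) : (avoidingPerms n pattern321).card = catalan n := by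
  have := card_avoidingIncreasing n 0 (Nat.zero_le _)
  rw [avoidingIncreasing_zero, ballot_zero_right] at this
  exact_mod_cast this

theorem isHillSequence_avoidingZ_321 (q : ℝ) :
    IsHillSequence (q - 1) fun n => avoidingZ n q pattern321 := by
  constructor
  · change avoidingZ 0 q pattern321 = 1
    rw [avoidingZ_eq_sum_prod, avoidingPerms_321_zero]
    simp
  · intro n
    simpa only [card_avoidingPerms_321] using avoidingZ_321_expand n q

/-! ### Truncated Catalan convolutions -/

theorem sum_antidiagonal_rotate {M : Type*} [AddCommMonoid M] (F : ℕ → ℕ → ℕ → M) (n : ℕ) :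
    ∑ p ∈ Finset.HasAntidiagonal.antidiagonal n,
      ∑ u ∈ Finset.HasAntidiagonal.antidiagonal p.1, F p.2 u.1 u.2 =
    ∑ p ∈ Finset.HasAntidiagonal.antidiagonal n,
      ∑ u ∈ Finset.HasAntidiagonal.antidiagonal p.1, F u.1 u.2 p.2 := by
  rw [Finset.sum_sigma', Finset.sum_sigma']
  refine Finset.sum_bij' (fun a _ => ⟨(a.1.2 + a.2.1, a.2.2), (a.1.2, a.2.1)⟩)
    (fun a _ => ⟨(a.2.2 + a.1.2, a.2.1), (a.2.2, a.1.2)⟩) ?_ ?_ ?_ ?_ ?_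
  all_goals
    rintro ⟨⟨a, b⟩, c, d⟩ h
    simp only [Finset.mem_sigma, Finset.HasAntidiagonal.mem_antidiagonal] at h
  · simp only [Finset.mem_sigma, Finset.HasAntidiagonal.mem_antidiagonal, and_true]; omega
  · simp only [Finset.mem_sigma, Finset.HasAntidiagonal.mem_antidiagonal, and_true]; omega
  · simp [h.2]
  · simp [h.2]
  · rfl

/-- The part of the convolution `∑ C_j z_i` over `j + i + 1 = n` where `d ≤ j`. -/
noncomputable def catalanTail (z : ℕ → ℝ) : ℕ → ℕ → ℝ
  | 0, _ => 0
  | n + 1, d => ∑ p ∈ Finset.HasAntidiagonal.antidiagonal n,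
      if d ≤ p.1 then (catalan p.1 : ℝ) * z p.2 else 0

theorem catalanTail_eq_zero (z : ℕ → ℝ) {n d : ℕ} (h : n ≤ d) : catalanTail z n d = 0 := by
  cases n with
  | zero => rfl
  | succ n =>
    refine Finset.sum_eq_zero fun p hp => if_neg ?_
    have := Finset.HasAntidiagonal.mem_antidiagonal.mp hp
    omega

theorem catalanTail_succ (z : ℕ → ℝ) (n d : ℕ) :
    catalanTail z (n + 1) d = catalanTail z (n + 1) (d + 1) +
      ∑ p ∈ Finset.HasAntidiagonal.antidiagonal n,
        if p.2 = d then (catalan p.2 : ℝ) * z p.1 else 0 := by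
  rw [← Finset.Nat.sum_antidiagonal_swap (f := fun p : ℕ × ℕ =>
    if p.2 = d then (catalan p.2 : ℝ) * z p.1 else 0)]
  simp only [catalanTail, ← Finset.sum_add_distrib, Prod.fst_swap, Prod.snd_swap]
  refine Finset.sum_congr rfl fun p _ => ?_
  split_ifs <;> first | omega | simp

theorem IsHillSequence.eq_catalanTail {t : ℝ} {z : ℕ → ℝ} (h : IsHillSequence t z) (n : ℕ) :
    z n = catalan n + t * catalanTail z n 0 := by
  cases n with
  | zero => simp [h.1, catalanTail]
  | succ n => simp [h.2, catalanTail]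

/-- After swapping the indices of the second sum, its condition reads d + u.2 + 1 ≤ u.1, while the
first says u.1 ≤ d + u.2 and d ≤ s. For d ≤ s exactly one of them holds, so the full Catalan
convolution remains; for d > s neither holds. -/
theorem sum_catalan_mul_indicator (d s : ℕ) :
    ∑ u ∈ Finset.HasAntidiagonal.antidiagonal s,
      ((catalan u.1 : ℝ) * (if ((d : ℤ) - u.1).natAbs ≤ u.2 then (catalan u.2 : ℝ) else 0) +
        (catalan u.1 : ℝ) * (if d + u.1 + 1 ≤ u.2 then (catalan u.2 : ℝ) else 0)) =
    if d ≤ s then (catalan (s + 1) : ℝ) else 0 := by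
  rw [Finset.sum_add_distrib, ← Finset.Nat.sum_antidiagonal_swap (f := fun u : ℕ × ℕ =>
    (catalan u.1 : ℝ) * (if d + u.1 + 1 ≤ u.2 then (catalan u.2 : ℝ) else 0)),
    ← Finset.sum_add_distrib, catalan_succ_antidiagonal_real]
  by_cases hds : d ≤ s
  swap
  · rw [if_neg hds]
    refine Finset.sum_eq_zero fun u hu => ?_
    have := Finset.HasAntidiagonal.mem_antidiagonal.mp hu
    simp only [Prod.fst_swap, Prod.snd_swap]
    rw [if_neg (by omega), if_neg (by omega), mul_zero, mul_zero, add_zero]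
  rw [if_pos hds]
  refine Finset.sum_congr rfl fun u hu => ?_
  have := Finset.HasAntidiagonal.mem_antidiagonal.mp hu
  simp only [Prod.fst_swap, Prod.snd_swap]
  split_ifs <;> first | omega | ring

/-- With the factor of `z` held fixed, the two Catalan factors are summed by
`sum_catalan_mul_indicator`. -/
theorem catalanTail_convolution (z : ℕ → ℝ) (n d : ℕ) :
    ∑ p ∈ Finset.HasAntidiagonal.antidiagonal n,
      ((catalan p.2 : ℝ) * catalanTail z p.1 ((d : ℤ) - p.2).natAbs +
        (catalan p.1 : ℝ) * catalanTail z p.2 (d + p.1 + 1)) =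
    catalanTail z (n + 1) (d + 1) := by
  rw [Finset.sum_add_distrib, ← Finset.Nat.sum_antidiagonal_swap (f := fun p : ℕ × ℕ =>
    (catalan p.1 : ℝ) * catalanTail z p.2 (d + p.1 + 1)), ← Finset.sum_add_distrib]
  simp only [Prod.fst_swap, Prod.snd_swap]
  cases n with
  | zero => simp [catalanTail]
  | succ n =>
    rw [Finset.Nat.sum_antidiagonal_succ]
    conv_rhs => rw [catalanTail, Finset.Nat.sum_antidiagonal_succ]
    simp only [catalanTail, mul_zero, add_zero, zero_add, Finset.mul_sum,
      ← Finset.sum_add_distrib]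
    rw [if_neg (by omega), zero_add]
    rw [sum_antidiagonal_rotate (fun m j i =>
      (catalan m : ℝ) * (if ((d : ℤ) - m).natAbs ≤ j then (catalan j : ℝ) * z i else 0) +
        (catalan m : ℝ) * (if d + m + 1 ≤ j then (catalan j : ℝ) * z i else 0))]
    refine Finset.sum_congr rfl fun p _ => ?_
    have := congrArg (· * z p.2) (sum_catalan_mul_indicator d p.1)
    simp only [Finset.sum_mul, ite_mul, zero_mul] at this
    simp only [Nat.add_le_add_iff_right]
    rw [← this]
    refine Finset.sum_congr rfl fun u _ => ?_
    split_ifs <;> ring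

/-- This is the recurrence that `shiftedSum_succ` yields for d ≥ 0. The product of the two tails
always vanishes, since one of them is truncated beyond its range, so only terms linear in them
survive. The extra q at p.2 = d supplies the term by which the tails at d and d + 1 differ. -/
theorem IsHillSequence.tail_recurrence {q : ℝ} {z : ℕ → ℝ} (h : IsHillSequence (q - 1) z)
    (n d : ℕ) :
    (catalan (n + 1) : ℝ) + (q - 1) * catalanTail z (n + 1) d =
      ∑ p ∈ Finset.HasAntidiagonal.antidiagonal n, (if p.2 = d then q else 1) *
        ((catalan p.1 + (q - 1) * catalanTail z p.1 ((d : ℤ) - p.2).natAbs) *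
          (catalan p.2 + (q - 1) * catalanTail z p.2 (d + p.1 + 1))) := by
  rw [catalanTail_succ, ← catalanTail_convolution, catalan_succ_antidiagonal_real, mul_add,
    Finset.mul_sum, Finset.mul_sum, ← Finset.sum_add_distrib, ← Finset.sum_add_distrib]
  refine Finset.sum_congr rfl fun p _ => ?_
  split_ifs with hd
  · have h0 : ((d : ℤ) - p.2).natAbs = 0 := by omega
    rw [h0, catalanTail_eq_zero z (show p.2 ≤ d + p.1 + 1 by omega), h.eq_catalanTail p.1]
    ring
  · rcases le_or_gt p.2 (d + p.1 + 1) with h1 | h1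
    · rw [catalanTail_eq_zero z h1]
      ring
    · rw [catalanTail_eq_zero z (show p.1 ≤ ((d : ℤ) - p.2).natAbs by omega)]
      ring

/-! ### 132-avoiders and shifted diagonals -/

theorem isBlockOffset_skewSum (k m : ℕ) : IsBlockOffset k m m (k + m) 0 := Or.inr ⟨rfl, rfl, rfl⟩

theorem glue_skewSum_mem_132 {k m : ℕ} (L : Equiv.Perm (Fin k)) (R : Equiv.Perm (Fin m)) :
    glue (isBlockOffset_skewSum k m) L R ∈ avoidingPerms _ pattern132 ↔
      L ∈ avoidingPerms k pattern132 ∧ R ∈ avoidingPerms m pattern132 := by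
  have hL : ∀ i, (L i : ℕ) < k := fun i => (L i).isLt
  have hR : ∀ i, (R i : ℕ) < m := fun i => (R i).isLt
  simp only [mem_avoidingPerms_132]
  simp only [Fin.forall_block, Fin.lt_def, glue_left, glue_mid, glue_right, Fin.val_castAdd,
    Fin.val_castSucc, Fin.val_natAdd, Fin.val_last]
  constructor
  · intro h
    refine ⟨fun x y z hxy hyz h1 h2 => (((h.1 x).1 y).1 z) hxy hyz (by omega) (by omega),
      fun x y z hxy hyz h1 h2 => (((h.2.2 x).2.2 y).2.2 z) (by omega) (by omega) (by omega)
        (by omega)⟩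
  · rintro ⟨h1, h2⟩
    refine ⟨fun x => ⟨fun y => ⟨fun z => ?_, ?_, fun z => ?_⟩, ⟨fun z => ?_, ?_, fun z => ?_⟩,
      fun y => ⟨fun z => ?_, ?_, fun z => ?_⟩⟩,
      ⟨fun y => ⟨fun z => ?_, ?_, fun z => ?_⟩, ⟨fun z => ?_, ?_, fun z => ?_⟩,
      fun y => ⟨fun z => ?_, ?_, fun z => ?_⟩⟩,
      fun x => ⟨fun y => ⟨fun z => ?_, ?_, fun z => ?_⟩, ⟨fun z => ?_, ?_, fun z => ?_⟩,
      fun y => ⟨fun z => ?_, ?_, fun z => ?_⟩⟩⟩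
    · intro hxy hyz a b
      exact h1 x y z hxy hyz (by omega) (by omega)
    all_goals try (have hx1 := hL x)
    all_goals try (have hx2 := hR x)
    all_goals try (have hy1 := hL y)
    all_goals try (have hy2 := hR y)
    all_goals try (have hz1 := hL z)
    all_goals try (have hz2 := hR z)
    all_goals try omega
    intro hxy hyz a b
    exact h2 x y z (by omega) (by omega) (by omega) (by omega)

/-- The maximum of a `132`-avoiding permutation splits it into a left block and a lower right
block. -/
theorem exists_glue_of_max_132 {k m : ℕ} {σ : Equiv.Perm (Fin (k + 1 + m))}
    (hσ : σ ∈ avoidingPerms _ pattern132)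
    (hmax : (σ (Fin.castAdd m (Fin.last k)) : ℕ) = k + m) :
    ∃ L R, glue (isBlockOffset_skewSum k m) L R = σ := by
  rw [mem_avoidingPerms_132] at hσ
  have hne : ∀ x, x ≠ Fin.castAdd m (Fin.last k) → (σ x : ℕ) < k + m := by
    intro x hx
    have h1 : (σ x : ℕ) ≠ k + m := fun h => hx (σ.injective (Fin.ext (h.trans hmax.symm)))
    have h2 := (σ x).isLt
    omega
  have hl : ∀ i : Fin k, (σ (Fin.castAdd m i.castSucc) : ℕ) < k + m := fun i => hne _ fun h => by
    have := congrArg Fin.val h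
    simp at this
    omega
  have hr : ∀ j : Fin m, (σ (Fin.natAdd (k + 1) j) : ℕ) < k + m := fun j => hne _ fun h => by
    have := congrArg Fin.val h
    simp at this
    omega
  have hlr : ∀ (i : Fin k) (j : Fin m), (σ (Fin.natAdd (k + 1) j) : ℕ) <
      σ (Fin.castAdd m i.castSucc) := by
    intro i j
    by_contra hcon
    have hneq : (σ (Fin.natAdd (k + 1) j) : ℕ) ≠ σ (Fin.castAdd m i.castSucc) := fun h => by
      have := congrArg Fin.val (σ.injective (Fin.ext h))
      simp at this
      omega
    refine hσ (Fin.castAdd m i.castSucc) (Fin.castAdd m (Fin.last k)) (Fin.natAdd (k + 1) j)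
      ?_ ?_ ?_ ?_
    · simp [Fin.lt_def]
    · simp [Fin.lt_def]; omega
    · rw [Fin.lt_def]; omega
    · rw [Fin.lt_def, hmax]; exact hr j
  refine exists_eq_glue _ σ (fun i => ⟨?_, by have := hl i; omega⟩) hmax
    fun j => ⟨Nat.zero_le _, ?_⟩
  · have := card_le_of_injective_lt (fun j : Fin m => σ (Fin.natAdd (k + 1) j))
      (fun _ _ h => by simpa using h) (hlr i)
    simpa using this
  -- The left entries and the maximum are k + 1 values above any given right entry, so that entry is
  -- below m.
  · have := add_card_lt_of_injective_lt (fun i : Fin (k + 1) => σ (Fin.castAdd m i))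
      (fun _ _ h => by simpa using h) (σ (Fin.natAdd (k + 1) j)).isLt (fun i => by
        induction i using Fin.lastCases with
        | last => rw [hmax]; exact hr j
        | cast i => exact hlr i j)
    rw [Fintype.card_fin] at this
    omega

/-- The sum over `132`-avoiding permutations of `q` to the number of entries lying on the diagonal
shifted by `d`. -/
noncomputable def shiftedSum (q : ℝ) (n : ℕ) (d : ℤ) : ℝ :=
  ∑ σ ∈ avoidingPerms n pattern132, ∏ i, if ((σ i : ℕ) : ℤ) = (i : ℕ) + d then q else 1

/-- In its own coordinates the left block has lost m in value, and the right block k + 1 in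
position, which gives the two new shifts. The maximum, at position k with value k + m, lies on the
diagonal exactly when m = d. -/
theorem sum_max_132 {n k m : ℕ} (h : k + 1 + m = n) (x : Fin n) (hx : (x : ℕ) = k) (q : ℝ)
    (d : ℤ) :
    ∑ σ ∈ (avoidingPerms n pattern132).filter (fun σ => (σ x : ℕ) = k + m),
      (∏ i, if ((σ i : ℕ) : ℤ) = (i : ℕ) + d then q else 1) =
    (if (m : ℤ) = d then q else 1) * (shiftedSum q k (d - m) * shiftedSum q m (d + k + 1)) := by
  subst h
  obtain rfl : x = Fin.castAdd m (Fin.last k) := Fin.ext (by simpa using hx)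
  rw [sum_glue (isBlockOffset_skewSum k m) _ (avoidingPerms k pattern132)
    (avoidingPerms m pattern132), shiftedSum, shiftedSum, Finset.sum_mul_sum, Finset.mul_sum]
  · refine Finset.sum_congr rfl fun L _ => ?_
    rw [Finset.mul_sum]
    refine Finset.sum_congr rfl fun R _ => ?_
    rw [Fin.prod_univ_block]
    simp only [glue_left, glue_mid, glue_right, Fin.val_castAdd, Fin.val_castSucc,
      Fin.val_natAdd, Fin.val_last]
    have e1 : ∀ i : Fin k, (((m + (L i : ℕ) : ℕ) : ℤ) = ((i : ℕ) : ℤ) + d) ↔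
        (((L i : ℕ) : ℤ) = (i : ℕ) + (d - m)) := fun i => by omega
    have e2 : (((k + m : ℕ) : ℤ) = (k : ℤ) + d) ↔ ((m : ℤ) = d) := by omega
    have e3 : ∀ j : Fin m, (((0 + (R j : ℕ) : ℕ) : ℤ) = ((k + 1 + (j : ℕ) : ℕ) : ℤ) + d) ↔
        (((R j : ℕ) : ℤ) = (j : ℕ) + (d + k + 1)) := fun j => by omega
    simp only [e1, e2, e3]
    ring
  · intro L R
    rw [Finset.mem_filter, glue_skewSum_mem_132, glue_mid]
    simp
  · intro σ hσ
    rw [Finset.mem_filter] at hσ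
    exact exists_glue_of_max_132 hσ.1 hσ.2

theorem shiftedSum_succ (q : ℝ) (n : ℕ) (d : ℤ) :
    shiftedSum q (n + 1) d = ∑ p ∈ Finset.HasAntidiagonal.antidiagonal n,
      (if (p.2 : ℤ) = d then q else 1) *
        (shiftedSum q p.1 (d - p.2) * shiftedSum q p.2 (d + p.1 + 1)) := by
  rw [Finset.Nat.sum_antidiagonal_eq_sum_range_succ (fun k m => (if (m : ℤ) = d then q else 1) *
    (shiftedSum q k (d - m) * shiftedSum q m (d + k + 1))), ← Fin.sum_univ_eq_sum_range
    (fun k => (if ((n - k : ℕ) : ℤ) = d then q else 1) *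
      (shiftedSum q k (d - (n - k : ℕ)) * shiftedSum q (n - k) (d + k + 1))), shiftedSum,
    ← Finset.sum_fiberwise _ fun σ => σ.symm (Fin.last n)]
  refine Finset.sum_congr rfl fun x _ => ?_
  rw [← sum_max_132 (n := n + 1) (k := x) (m := n - x) (by omega) x rfl]
  refine Finset.sum_congr (Finset.filter_congr fun σ _ => ?_) fun _ _ => rfl
  rw [Equiv.symm_apply_eq, Fin.ext_iff, Fin.val_last]
  have := x.isLt
  omega

theorem inv_mem_avoidingPerms_132 {n : ℕ} {σ : Equiv.Perm (Fin n)}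
    (hσ : σ ∈ avoidingPerms n pattern132) : σ⁻¹ ∈ avoidingPerms n pattern132 := by
  rw [mem_avoidingPerms_132] at hσ ⊢
  intro x y z hxy hyz h1 h2
  refine hσ (σ⁻¹ x) (σ⁻¹ z) (σ⁻¹ y) h1 h2 ?_ ?_ <;> simpa

/-- Inversion reflects the diagram in the main diagonal and preserves avoidance of the involution
132. -/
theorem shiftedSum_neg (q : ℝ) (n : ℕ) (d : ℤ) : shiftedSum q n (-d) = shiftedSum q n d := by
  refine Finset.sum_bij' (fun σ _ => σ⁻¹) (fun σ _ => σ⁻¹)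
    (fun σ hσ => inv_mem_avoidingPerms_132 hσ) (fun σ hσ => inv_mem_avoidingPerms_132 hσ)
    (fun σ _ => inv_inv σ) (fun σ _ => inv_inv σ) fun σ _ => ?_
  refine Fintype.prod_equiv σ _ _ fun i => ?_
  rw [show σ⁻¹ (σ i) = i from σ.symm_apply_apply i]
  refine if_congr ?_ rfl rfl
  omega

/-- Both sides obey the same recurrence on the length. Cutting produces shifts of either sign, so
the induction runs over all integers d, and `shiftedSum_neg` reduces each step to d ≥ 0. -/
theorem IsHillSequence.shiftedSum_eq {q : ℝ} {z : ℕ → ℝ} (h : IsHillSequence (q - 1) z) (n : ℕ)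
    (d : ℤ) : shiftedSum q n d = catalan n + (q - 1) * catalanTail z n d.natAbs := by
  induction n using Nat.strong_induction_on generalizing d with
  | _ n ih =>
    have hred : shiftedSum q n d = shiftedSum q n (d.natAbs : ℤ) := by
      rcases Int.natAbs_eq d with hd | hd
      · rw [← hd]
      · rw [show (d.natAbs : ℤ) = -d by omega, shiftedSum_neg]
    rw [hred]
    generalize d.natAbs = e
    cases n with
    | zero =>
      have : avoidingPerms 0 pattern132 = Finset.univ :=
        Finset.eq_univ_iff_forall.mpr fun _ => mem_avoidingPerms_132.mpr fun x => x.elim0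
      rw [shiftedSum, this]
      simp [catalanTail]
    | succ n =>
      rw [shiftedSum_succ, h.tail_recurrence]
      refine Finset.sum_congr rfl fun p hp => ?_
      have := Finset.HasAntidiagonal.mem_antidiagonal.mp hp
      rw [ih _ (by omega), ih _ (by omega),
        show ((e : ℤ) + p.1 + 1).natAbs = e + p.1 + 1 by omega]
      simp only [Nat.cast_inj]

theorem avoidingZ_132 (n : ℕ) (q : ℝ) : avoidingZ n q pattern132 = avoidingZ n q pattern321 := by
  have h := isHillSequence_avoidingZ_321 q
  have h1 := h.shiftedSum_eq n 0
  rw [Int.natAbs_zero, ← h.eq_catalanTail] at h1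
  rw [← h1, avoidingZ_eq_sum_prod, shiftedSum]
  refine Finset.sum_congr rfl fun σ _ => Finset.prod_congr rfl fun i _ => if_congr ?_ rfl rfl
  rw [Fin.ext_iff]
  omega

/-! ### The asymptotics for the three patterns -/

theorem lemma3p1 (q : ℝ) (hq : 0 < q) (τ : Equiv.Perm (Fin 3))
    (hτ : τ = pattern132 ∨ τ = pattern321 ∨ τ = pattern213) :
    (q < 3 → (fun n : ℕ => avoidingZ n q τ) ~[atTop]
      (fun n : ℕ => 4 / ((3 - q) ^ 2 * Real.sqrt Real.pi) * (n : ℝ) ^ (-(3 / 2) : ℝ)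
        * (4 : ℝ) ^ n)) ∧
    (q = 3 → (fun n : ℕ => avoidingZ n q τ) ~[atTop]
      (fun n : ℕ => 2 / Real.sqrt Real.pi * (n : ℝ) ^ (-(1 / 2) : ℝ) * (4 : ℝ) ^ n)) ∧
    (3 < q → (fun n : ℕ => avoidingZ n q τ) ~[atTop]
      (fun n : ℕ => (q - 1) * (q - 3) / (q - 2) ^ 2 * ((q - 1) ^ 2 / (q - 2)) ^ n)) := by
  have hz : IsHillSequence (q - 1) fun n => avoidingZ n q τ := by
    rcases hτ with rfl | rfl | rfl
    · simpa only [avoidingZ_132] using isHillSequence_avoidingZ_321 q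
    · exact isHillSequence_avoidingZ_321 q
    · simpa only [avoidingZ_213, avoidingZ_132] using isHillSequence_avoidingZ_321 q
  refine ⟨fun h => ?_, fun h => ?_, fun h => ?_⟩
  · have := hz.isEquivalent_of_abs_lt_two (abs_lt.mpr ⟨by linarith, by linarith⟩)
    rwa [show 2 - (q - 1) = 3 - q by ring] at this
  · refine IsHillSequence.isEquivalent_of_eq_two ?_
    rwa [show q - 1 = 2 by linarith] at hz
  · have := hz.isEquivalent_of_two_lt (by linarith)
    rwa [show q - 1 - 2 = q - 3 by ring, show q - 1 - 1 = q - 2 by ring] at this
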